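/- **Theorem 1 (Sinkhorn loss).** Let $X$ be a metric space and let $\mu,\nu$ be Radon probability measures on $X$. Let $c:X\times X\to\mathbb R$ be a continuous cost that is integrable with respect to $\mu\otimes\nu$, $\mu\otimes\mu$ and $\nu\otimes\nu$, and suppose that $c(x,y)\ge -(a(x)+a(y))$ for some function $a\in L^1(\mu)\cap L^1(\nu)$ (for example, $c$ is bounded below). For $\alpha,\beta\in\{\mu,\nu\}$ let $\Pi(\alpha,\beta)$ be the set of probability measures on $X\times X$ with marginals $\alpha$ and $\beta$, and let $$W_c(\alpha,\beta)=\inf_{\pi\in\Pi(\alpha,\beta)}\int c\,d\pi .$$ For $\varepsilon>0$ consider the entropy-regularized problem $$\min_{\pi\in\Pi(\alpha,\beta)}\ \int c\,d\pi+\varepsilon\int\log\frac{d\pi}{d(\alpha\otimes\beta)}\,d\pi ,$$ where the second integral is $+\infty$ if $\pi$ is not absolutely continuous with respect to $\alpha\otimes\beta$. Then, for $(\alpha,\beta)\in\{(\mu,\nu),(\mu,\mu),(\nu,\nu)\}$, this problem has a unique minimizer $\pi_\varepsilon^{\alpha,\beta}$. Put $W_{c,\varepsilon}(\alpha,\beta)=\int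 c\,d\pi_\varepsilon^{\alpha,\beta}$ and define the Sinkhorn loss by $$\overline W_{c,\varepsilon}(\mu,\nu)=2W_{c,\varepsilon}(\mu,\nu)-W_{c,\varepsilon}(\mu,\mu)-W_{c,\varepsilon}(\nu,\nu).$$ 1. If moreover $c\ge 0$ and $c(x,x)=0$ for all $x\in X$, then $\overline W_{c,\varepsilon}(\mu,\nu)\to 2W_c(\mu,\nu)$ as $\varepsilon\to0^+$. 2. As $\varepsilon\to+\infty$, $\overline W_{c,\varepsilon}(\mu,\nu)\to \mathrm{MMD}_{-c}(\mu,\nu)$, where for a kernel $k$ $$\mathrm{MMD}_k(\mu,\nu)=\int k\,d(\mu\otimes\mu)+\int k\,d(\nu\otimes\nu)-2\int k\,d(\mu\otimes\nu);$$ moreover $\pi_\varepsilon^{\mu,\nu}\to\mu\otimes\nu$ weakly (tested against bounded continuous functions on $X\times X$). -/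

import Mathlib

open MeasureTheory Filter Topology

namespace Sinkhorn

variable {X : Type*} [MeasurableSpace X]

/-- The couplings `Π(μ, ν)`: measures on the product with marginals `μ` and `ν`
(automatically of unit mass when `μ` is). -/
def couplings (μ ν : Measure X) : Set (Measure (X × X)) :=
  {π | π.map Prod.fst = μ ∧ π.map Prod.snd = ν}

/-- The unregularized optimal transport cost `W_c(μ, ν)`: the infimum of `∫ c dπ` over the
couplings of finite cost. (For `c` bounded below by an integrable `f(x) + g(y)`, the remaining
couplings have cost `+∞`.) -/
noncomputable def otCost (c : X × X → ℝ) (μ ν : Measure X) : ℝ :=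
  sInf {r : ℝ | ∃ π ∈ couplings μ ν, Integrable c π ∧ r = ∫ z, c z ∂π}

/-- The objective `∫ c dπ + ε ∫ log (dπ / d(μ ⊗ ν)) dπ` of the entropy-regularized problem,
meaningful where both terms are finite. -/
noncomputable def regObjective (c : X × X → ℝ) (ε : ℝ) (μ ν : Measure X)
    (π : Measure (X × X)) : ℝ :=
  ∫ z, c z ∂π + ε * (InformationTheory.klDiv π (μ.prod ν)).toReal

/-- The couplings at which the regularized objective is finite: finite cost, and finite relative
entropy with respect to `μ ⊗ ν` (the entropy is `+∞` if `π` is not absolutely continuous). -/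
def finiteCouplings (c : X × X → ℝ) (μ ν : Measure X) : Set (Measure (X × X)) :=
  {π | π ∈ couplings μ ν ∧ Integrable c π ∧ InformationTheory.klDiv π (μ.prod ν) ≠ ⊤}

/-- `π` is an optimal coupling for the entropy-regularized problem: a minimizer of the
regularized objective over all couplings, those outside `finiteCouplings` counting as `+∞`. -/
def IsRegOptimal (c : X × X → ℝ) (ε : ℝ) (μ ν : Measure X) (π : Measure (X × X)) : Prop :=
  π ∈ finiteCouplings c μ ν ∧
    ∀ π' ∈ finiteCouplings c μ ν, regObjective c ε μ ν π ≤ regObjective c ε μ ν π'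

open Classical in
/-- The optimal coupling `π_ε` of the entropy-regularized problem (`0` if there is none). -/
noncomputable def regCoupling (c : X × X → ℝ) (ε : ℝ) (μ ν : Measure X) : Measure (X × X) :=
  if h : ∃ π, IsRegOptimal c ε μ ν π then h.choose else 0

/-- `W_{c,ε}(μ, ν) = ∫ c dπ_ε`. -/
noncomputable def regCost (c : X × X → ℝ) (ε : ℝ) (μ ν : Measure X) : ℝ :=
  ∫ z, c z ∂(regCoupling c ε μ ν)

/-- The Sinkhorn loss `2 W_{c,ε}(μ, ν) - W_{c,ε}(μ, μ) - W_{c,ε}(ν, ν)`. -/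
noncomputable def sinkhornLoss (c : X × X → ℝ) (ε : ℝ) (μ ν : Measure X) : ℝ :=
  2 * regCost c ε μ ν - regCost c ε μ μ - regCost c ε ν ν

/-- The maximum mean discrepancy with kernel `k`:
`E_{μ⊗μ}[k(X, X')] + E_{ν⊗ν}[k(Y, Y')] - 2 E_{μ⊗ν}[k(X, Y)]`. -/
noncomputable def mmd (k : X × X → ℝ) (μ ν : Measure X) : ℝ :=
  ∫ z, k z ∂(μ.prod μ) + ∫ z, k z ∂(ν.prod ν) - 2 * ∫ z, k z ∂(μ.prod ν)

end Sinkhorn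

/-!
Everything rests on writing a coupling of finite entropy as `p • (α ⊗ β)` with a density `p`, and
on one inequality: the Bregman divergence of `t log t` dominates the squared Hellinger distance
`(√s - √t) ^ 2`. Hence the regularized objective is uniformly convex, with a gain at midpoints
that controls the `L¹` distance of densities (`densityObjective_midpoint_add_le`,
`integral_abs_sub_le`).

*Existence and uniqueness.* Minimizing sequences of densities are Cauchy in `L¹`. The marginal
constraints are closed in `L¹`, and after adding `a ⊕ a`, whose integral is the same for all
couplings, the integrand is nonnegative and Fatou's lemma gives lower semicontinuity. No weak
compactness is used.

*Large `ε`.* Comparison with the product coupling shows that the relative entropy of the optimal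
coupling is `O(1 / ε)`, so its density tends to `1` in `L¹`. This gives convergence against
bounded functions. For the cost, the same comparison gives the upper bound and truncation of
`c + a ⊕ a` the lower bound.

*Small `ε`.* The optimal coupling is compared with any fixed coupling of finite entropy, so it
suffices that every coupling `π` of finite cost can be approximated, in cost, by couplings of finite
entropy (`exists_isPlanDensity_integral_le`). On a compact square carrying most of the mass, `c` is
uniformly continuous, and averaging `π` over small blocks yields a bounded subdensity `Q` of nearly
the same cost. To restore the marginals, `Q` is scaled by `1 - l` and completed by the normalized
product of the missing marginals (`exists_completion`). Because a fraction `l` of both marginals is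
missing everywhere, this product has density at most `1 / l`, which together with integrability of
`c` with respect to `α ⊗ β` makes its cost small. Finally the diagonal coupling shows
`otCost c α α = 0`.
-/

namespace Sinkhorn

open InformationTheory

section Densities

/-! ### Quantitative convexity of `t log t` -/

/-- The Bregman divergence of `t log t` dominates the squared Hellinger distance. -/
lemma sq_sqrt_sub_sqrt_le_bregman {s m : ℝ} (hs : 0 ≤ s) (hm : 0 < m) :
    (√s - √m) ^ 2 ≤ s * Real.log s - s * Real.log m - s + m := by
  rcases hs.eq_or_lt with rfl | hs
  · simp [Real.sq_sqrt hm.le]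
  have hss : 0 < √s := Real.sqrt_pos.2 hs
  have hsm : 0 < √m := Real.sqrt_pos.2 hm
  have h1 : Real.log (√m / √s) ≤ √m / √s - 1 := Real.log_le_sub_one_of_pos (by positivity)
  rw [Real.log_div hsm.ne' hss.ne', Real.log_sqrt hs.le, Real.log_sqrt hm.le] at h1
  have h2 : s * (√m / √s) = √s * √m := by
    nth_rewrite 1 [← Real.mul_self_sqrt hs.le]
    field_simp
  have h3 := mul_le_mul_of_nonneg_left h1 hs.le
  have h4 := Real.sq_sqrt hs.le
  have h5 := Real.sq_sqrt hm.le
  nlinarith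

/-- Midpoint convexity of `klFun`, with a squared Hellinger distance to spare. -/
lemma klFun_midpoint_add_le {s t : ℝ} (hs : 0 ≤ s) (ht : 0 ≤ t) :
    klFun ((s + t) / 2) + (√s - √t) ^ 2 / 4 ≤ (klFun s + klFun t) / 2 := by
  rcases (add_nonneg hs ht).eq_or_lt with h | h
  · obtain rfl : s = 0 := by linarith
    obtain rfl : t = 0 := by linarith
    simp
  have hm : 0 < (s + t) / 2 := by linarith
  have h1 := sq_sqrt_sub_sqrt_le_bregman hs hm
  have h2 := sq_sqrt_sub_sqrt_le_bregman ht hm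
  simp only [klFun_apply]
  nlinarith [sq_nonneg (√s + √t - 2 * √((s + t) / 2))]

lemma sq_sqrt_sub_one_le_klFun {s : ℝ} (hs : 0 ≤ s) : (√s - 1) ^ 2 ≤ klFun s := by
  have := sq_sqrt_sub_sqrt_le_bregman hs one_pos
  simp only [Real.sqrt_one, Real.log_one] at this
  rw [klFun_apply]
  linarith

lemma abs_sub_le_sq_sqrt_sub_sqrt {s t δ : ℝ} (hs : 0 ≤ s) (ht : 0 ≤ t) (hδ : 0 < δ) :
    |s - t| ≤ (√s - √t) ^ 2 / (2 * δ) + δ * (s + t) := by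
  have h4 := Real.sq_sqrt hs
  have h5 := Real.sq_sqrt ht
  have e : |s - t| = |√s - √t| * (√s + √t) := by
    rw [← abs_of_nonneg (show 0 ≤ √s + √t by positivity), ← abs_mul]
    congr 1
    linear_combination -h4 + h5
  have h6 : (√s + √t) ^ 2 ≤ 2 * (s + t) := by nlinarith [sq_nonneg (√s - √t)]
  have h7 : |√s - √t| * (√s + √t) ≤ (√s - √t) ^ 2 / (2 * δ) + δ / 2 * (√s + √t) ^ 2 := by
    rw [← sq_abs (√s - √t)]
    set u := |√s - √t|
    set v := √s + √t
    have : u ^ 2 / (2 * δ) + δ / 2 * v ^ 2 - u * v = (u - δ * v) ^ 2 / (2 * δ) := by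
      field_simp
      ring
    have : 0 ≤ (u - δ * v) ^ 2 / (2 * δ) := by positivity
    linarith
  rw [e]
  nlinarith

/-! ### Couplings as probability densities -/

variable {X : Type*} [MeasurableSpace X]

/-- `p` is the density with respect to `α ⊗ β` of a coupling of `α` and `β` of finite cost and
finite relative entropy. A density is taken to be everywhere nonnegative and measurable. -/
structure IsPlanDensity (c : X × X → ℝ) (α β : Measure X) (p : X × X → ℝ) : Prop where
  measurable : Measurable p
  nonneg : ∀ z, 0 ≤ p z
  integrable : Integrable p (α.prod β)
  fst : ∀ A, MeasurableSet A → ∫ z in Prod.fst ⁻¹' A, p z ∂(α.prod β) = α.real A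
  snd : ∀ A, MeasurableSet A → ∫ z in Prod.snd ⁻¹' A, p z ∂(α.prod β) = β.real A
  cost : Integrable (fun z => p z * c z) (α.prod β)
  entropy : Integrable (fun z => klFun (p z)) (α.prod β)

/-- The regularized objective, as a function of the density. -/
noncomputable def densityObjective (c : X × X → ℝ) (ε : ℝ) (α β : Measure X)
    (p : X × X → ℝ) : ℝ :=
  ∫ z, p z * c z ∂(α.prod β) + ε * ∫ z, klFun (p z) ∂(α.prod β)

section WithDensity

variable {Ω : Type*} [MeasurableSpace Ω] {ρ : Measure Ω} {p : Ω → ℝ}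

lemma integrable_withDensity_ofReal_iff (hp : Measurable p) (h0 : ∀ z, 0 ≤ p z) {f : Ω → ℝ} :
    Integrable f (ρ.withDensity fun z => ENNReal.ofReal (p z)) ↔
      Integrable (fun z => p z * f z) ρ := by
  rw [integrable_withDensity_iff_integrable_smul' hp.ennreal_ofReal (by simp)]
  simp [ENNReal.toReal_ofReal (h0 _)]

lemma integral_withDensity_ofReal (hp : Measurable p) (h0 : ∀ z, 0 ≤ p z) (f : Ω → ℝ) :
    ∫ z, f z ∂(ρ.withDensity fun z => ENNReal.ofReal (p z)) = ∫ z, p z * f z ∂ρ := by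
  rw [integral_withDensity_eq_integral_toReal_smul hp.ennreal_ofReal (by simp)]
  simp [ENNReal.toReal_ofReal (h0 _)]

lemma withDensity_ofReal_apply (h0 : ∀ z, 0 ≤ p z) (hi : Integrable p ρ)
    {A : Set Ω} (hA : MeasurableSet A) :
    (ρ.withDensity fun z => ENNReal.ofReal (p z)) A = ENNReal.ofReal (∫ z in A, p z ∂ρ) := by
  rw [withDensity_apply _ hA, ofReal_integral_eq_lintegral_ofReal hi.integrableOn
    (ae_of_all _ h0)]

end WithDensity

variable {c : X × X → ℝ} {ε : ℝ} {α β : Measure X} {p : X × X → ℝ}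

lemma isProbabilityMeasure_of_mem_couplings [IsProbabilityMeasure α] {π : Measure (X × X)}
    (h : π ∈ couplings α β) : IsProbabilityMeasure π := by
  have : IsProbabilityMeasure (π.map Prod.fst) := by rw [h.1]; infer_instance
  exact Measure.isProbabilityMeasure_of_map Prod.fst

lemma prod_mem_couplings [IsProbabilityMeasure α] [IsProbabilityMeasure β] :
    α.prod β ∈ couplings α β := by
  constructor <;> simp

namespace IsPlanDensity

/-- The coupling with density `p`. -/
noncomputable def plan (α β : Measure X) (p : X × X → ℝ) : Measure (X × X) :=
  (α.prod β).withDensity fun z => ENNReal.ofReal (p z)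

lemma integral_plan (h : IsPlanDensity c α β p) (f : X × X → ℝ) :
    ∫ z, f z ∂(plan α β p) = ∫ z, p z * f z ∂(α.prod β) :=
  integral_withDensity_ofReal h.measurable h.nonneg f

lemma integrable_mul_iff (h : IsPlanDensity c α β p) {f : X × X → ℝ} :
    Integrable (fun z => p z * f z) (α.prod β) ↔ Integrable f (plan α β p) :=
  (integrable_withDensity_ofReal_iff h.measurable h.nonneg).symm

variable [IsProbabilityMeasure α] [IsProbabilityMeasure β]

lemma plan_mem_couplings (h : IsPlanDensity c α β p) : plan α β p ∈ couplings α β := by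
  constructor
  · ext A hA
    rw [Measure.map_apply measurable_fst hA, plan,
      withDensity_ofReal_apply h.nonneg h.integrable (measurable_fst hA), h.fst A hA,
      ofReal_measureReal]
  · ext A hA
    rw [Measure.map_apply measurable_snd hA, plan,
      withDensity_ofReal_apply h.nonneg h.integrable (measurable_snd hA), h.snd A hA,
      ofReal_measureReal]

lemma rnDeriv_plan (h : IsPlanDensity c α β p) :
    (fun z => ((plan α β p).rnDeriv (α.prod β) z).toReal) =ᵐ[α.prod β] p := by
  filter_upwards [Measure.rnDeriv_withDensity (α.prod β) h.measurable.ennreal_ofReal] with z hz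
  rw [plan, hz, ENNReal.toReal_ofReal (h.nonneg z)]

lemma klDiv_plan (h : IsPlanDensity c α β p) :
    klDiv (plan α β p) (α.prod β) = ENNReal.ofReal (∫ z, klFun (p z) ∂(α.prod β)) := by
  have := isProbabilityMeasure_of_mem_couplings h.plan_mem_couplings
  have hac : plan α β p ≪ α.prod β := withDensity_absolutelyContinuous _ _
  rw [klDiv_eq_lintegral_klFun_of_ac hac,
    ofReal_integral_eq_lintegral_ofReal h.entropy
      (ae_of_all _ fun z => klFun_nonneg (h.nonneg z))]
  refine lintegral_congr_ae ?_
  filter_upwards [h.rnDeriv_plan] with z hz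
  rw [hz]

lemma plan_mem_finiteCouplings (h : IsPlanDensity c α β p) :
    plan α β p ∈ finiteCouplings c α β :=
  ⟨h.plan_mem_couplings, (integrable_withDensity_ofReal_iff h.measurable h.nonneg).2 h.cost,
    by simp [h.klDiv_plan]⟩

lemma regObjective_plan (h : IsPlanDensity c α β p) :
    regObjective c ε α β (plan α β p) = densityObjective c ε α β p := by
  rw [regObjective, densityObjective, h.integral_plan, h.klDiv_plan, ENNReal.toReal_ofReal
    (integral_nonneg fun z => klFun_nonneg (h.nonneg z))]

end IsPlanDensity

open IsPlanDensity

lemma exists_isPlanDensity_of_mem_finiteCouplings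
    [IsProbabilityMeasure α] [IsProbabilityMeasure β] {π : Measure (X × X)}
    (h : π ∈ finiteCouplings c α β) : ∃ p, IsPlanDensity c α β p ∧ π = plan α β p := by
  obtain ⟨hπ, hc, hk⟩ := h
  have := isProbabilityMeasure_of_mem_couplings hπ
  obtain ⟨hac, hllr⟩ := klDiv_ne_top_iff.1 hk
  set p : X × X → ℝ := fun z => (π.rnDeriv (α.prod β) z).toReal
  have hp : Measurable p := (Measure.measurable_rnDeriv _ _).ennreal_toReal
  have h0 : ∀ z, 0 ≤ p z := fun z => ENNReal.toReal_nonneg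
  have e : π = plan α β p := by
    conv_lhs => rw [← Measure.withDensity_rnDeriv_eq _ _ hac]
    refine withDensity_congr_ae ?_
    filter_upwards [Measure.rnDeriv_lt_top π (α.prod β)] with z hz
    rw [ENNReal.ofReal_toReal hz.ne]
  have hi : Integrable p (α.prod β) := Measure.integrable_toReal_rnDeriv
  refine ⟨p, ⟨hp, h0, hi, fun A hA => ?_, fun A hA => ?_, ?_,
    (integrable_klFun_rnDeriv_iff hac).2 hllr⟩, e⟩
  · rw [Measure.setIntegral_toReal_rnDeriv hac, ← hπ.1, map_measureReal_apply measurable_fst hA]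
  · rw [Measure.setIntegral_toReal_rnDeriv hac, ← hπ.2, map_measureReal_apply measurable_snd hA]
  · rw [e] at hc
    exact (integrable_withDensity_ofReal_iff hp h0).1 hc

end Densities

section Minimizer

open IsPlanDensity

variable {X : Type*} [MeasurableSpace X]

/-! ### Existence and uniqueness of the regularized optimal coupling -/

/-- Fatou's lemma for nonnegative integrable functions with convergent integrals. -/
lemma integrable_and_integral_le_of_tendsto {Ω : Type*} [MeasurableSpace Ω] {ρ : Measure Ω}
    {f : ℕ → Ω → ℝ} {g : Ω → ℝ} {I : ℝ} (hf : ∀ n, Integrable (f n) ρ) (h0 : ∀ n z, 0 ≤ f n z)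
    (hlim : ∀ᵐ z ∂ρ, Tendsto (fun n => f n z) atTop (𝓝 (g z)))
    (hI : Tendsto (fun n => ∫ z, f n z ∂ρ) atTop (𝓝 I)) :
    Integrable g ρ ∧ ∫ z, g z ∂ρ ≤ I := by
  have hg : AEStronglyMeasurable g ρ :=
    aestronglyMeasurable_of_tendsto_ae atTop (fun n => (hf n).aestronglyMeasurable) hlim
  have hg0 : 0 ≤ᵐ[ρ] g := by
    filter_upwards [hlim] with z hz using ge_of_tendsto' hz fun n => h0 n z
  have hI0 : 0 ≤ I := ge_of_tendsto' hI fun n => integral_nonneg (h0 n)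
  have key : ∫⁻ z, ENNReal.ofReal (g z) ∂ρ ≤ ENNReal.ofReal I := by
    calc ∫⁻ z, ENNReal.ofReal (g z) ∂ρ
        = ∫⁻ z, liminf (fun n => ENNReal.ofReal (f n z)) atTop ∂ρ := by
          refine lintegral_congr_ae ?_
          filter_upwards [hlim] with z hz
          exact ((ENNReal.continuous_ofReal.tendsto _).comp hz).liminf_eq.symm
      _ ≤ liminf (fun n => ∫⁻ z, ENNReal.ofReal (f n z) ∂ρ) atTop :=
          lintegral_liminf_le' fun n => (hf n).aestronglyMeasurable.aemeasurable.ennreal_ofReal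
      _ = ENNReal.ofReal I := by
          simp_rw [← fun n => ofReal_integral_eq_lintegral_ofReal (hf n) (ae_of_all _ (h0 n))]
          exact ((ENNReal.continuous_ofReal.tendsto _).comp hI).liminf_eq
  have hgi : Integrable g ρ :=
    (lintegral_ofReal_ne_top_iff_integrable hg hg0).1 (key.trans_lt ENNReal.ofReal_lt_top).ne
  refine ⟨hgi, ?_⟩
  rw [← ofReal_integral_eq_lintegral_ofReal hgi hg0] at key
  exact (ENNReal.ofReal_le_ofReal_iff hI0).1 key

lemma integrable_add_of_mem_couplings {α β : Measure X} {π : Measure (X × X)}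
    (hπ : π ∈ couplings α β) {a b : X → ℝ} (ha : Integrable a α) (hb : Integrable b β) :
    Integrable (fun z => a z.1 + b z.2) π ∧
      ∫ z, (a z.1 + b z.2) ∂π = ∫ x, a x ∂α + ∫ y, b y ∂β := by
  have h1 : MeasurePreserving Prod.fst π α := ⟨measurable_fst, hπ.1⟩
  have h2 : MeasurePreserving Prod.snd π β := ⟨measurable_snd, hπ.2⟩
  have i1 : Integrable (fun z => a z.1) π := h1.integrable_comp_of_integrable ha
  have i2 : Integrable (fun z => b z.2) π := h2.integrable_comp_of_integrable hb
  refine ⟨i1.add i2, ?_⟩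
  rw [integral_add i1 i2]
  congr 1
  · rw [← hπ.1, integral_map measurable_fst.aemeasurable (by rw [hπ.1]; exact ha.1)]
  · rw [← hπ.2, integral_map measurable_snd.aemeasurable (by rw [hπ.2]; exact hb.1)]

variable {c : X × X → ℝ} {ε : ℝ} {α β : Measure X} {p q : X × X → ℝ} {a b : X → ℝ}

namespace IsPlanDensity

lemma integrable_sq_sqrt_sub_sqrt (hp : IsPlanDensity c α β p) (hq : IsPlanDensity c α β q) :
    Integrable (fun z => (√(p z) - √(q z)) ^ 2) (α.prod β) := by
  refine ((hp.integrable.add hq.integrable).const_mul 2).mono'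
    ((hp.measurable.sqrt.sub hq.measurable.sqrt).pow_const 2).aestronglyMeasurable
    (ae_of_all _ fun z => ?_)
  rw [Real.norm_of_nonneg (sq_nonneg _), Pi.add_apply]
  nlinarith [Real.sq_sqrt (hp.nonneg z), Real.sq_sqrt (hq.nonneg z),
    sq_nonneg (√(p z) + √(q z))]

lemma midpoint (hp : IsPlanDensity c α β p) (hq : IsPlanDensity c α β q) :
    IsPlanDensity c α β fun z => (p z + q z) / 2 where
  measurable := (hp.measurable.add hq.measurable).div_const 2
  nonneg z := by have := hp.nonneg z; have := hq.nonneg z; positivity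
  integrable := (hp.integrable.add hq.integrable).div_const 2
  fst A hA := by
    rw [integral_div, integral_add hp.integrable.integrableOn hq.integrable.integrableOn,
      hp.fst A hA, hq.fst A hA]
    ring
  snd A hA := by
    rw [integral_div, integral_add hp.integrable.integrableOn hq.integrable.integrableOn,
      hp.snd A hA, hq.snd A hA]
    ring
  cost := ((hp.cost.add hq.cost).div_const 2).congr
    (ae_of_all _ fun z => by simp only [Pi.add_apply]; ring)
  entropy := by
    refine ((hp.entropy.add hq.entropy).div_const 2).mono' (measurable_klFun.comp
      ((hp.measurable.add hq.measurable).div_const 2)).aestronglyMeasurable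
      (ae_of_all _ fun z => ?_)
    have := hp.nonneg z
    have := hq.nonneg z
    rw [Real.norm_of_nonneg (klFun_nonneg (by positivity)), Pi.add_apply]
    have := klFun_midpoint_add_le (hp.nonneg z) (hq.nonneg z)
    nlinarith [sq_nonneg (√(p z) - √(q z))]

lemma integral_klFun_nonneg (h : IsPlanDensity c α β p) :
    0 ≤ ∫ z, klFun (p z) ∂(α.prod β) :=
  integral_nonneg fun z => klFun_nonneg (h.nonneg z)

/-- The objective is uniformly convex with respect to the Hellinger distance. -/
lemma densityObjective_midpoint_add_le (hε : 0 ≤ ε) (hp : IsPlanDensity c α β p)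
    (hq : IsPlanDensity c α β q) :
    densityObjective c ε α β (fun z => (p z + q z) / 2) +
        ε / 4 * ∫ z, (√(p z) - √(q z)) ^ 2 ∂(α.prod β) ≤
      (densityObjective c ε α β p + densityObjective c ε α β q) / 2 := by
  have e1 : ∫ z, (p z + q z) / 2 * c z ∂(α.prod β) =
      (∫ z, p z * c z ∂(α.prod β) + ∫ z, q z * c z ∂(α.prod β)) / 2 := by
    rw [← integral_add hp.cost hq.cost, ← integral_div]
    congr with z
    ring
  have i := (hp.integrable_sq_sqrt_sub_sqrt hq).div_const 4
  have e2 : ∫ z, klFun ((p z + q z) / 2) ∂(α.prod β) +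
      (∫ z, (√(p z) - √(q z)) ^ 2 ∂(α.prod β)) / 4 ≤
      (∫ z, klFun (p z) ∂(α.prod β) + ∫ z, klFun (q z) ∂(α.prod β)) / 2 := by
    rw [← integral_add hp.entropy hq.entropy, ← integral_div, ← integral_div,
      ← integral_add (hp.midpoint hq).entropy i]
    exact integral_mono ((hp.midpoint hq).entropy.add i)
      ((hp.entropy.add hq.entropy).div_const 2)
      fun z => klFun_midpoint_add_le (hp.nonneg z) (hq.nonneg z)
  simp only [densityObjective]
  rw [e1]
  nlinarith [mul_le_mul_of_nonneg_left e2 hε]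

variable [IsProbabilityMeasure α]

lemma integral_eq_one (h : IsPlanDensity c α β p) : ∫ z, p z ∂(α.prod β) = 1 := by
  simpa using h.fst Set.univ MeasurableSet.univ

lemma integral_abs_sub_le (hp : IsPlanDensity c α β p) (hq : IsPlanDensity c α β q)
    {δ : ℝ} (hδ : 0 < δ) :
    ∫ z, |p z - q z| ∂(α.prod β) ≤
      (∫ z, (√(p z) - √(q z)) ^ 2 ∂(α.prod β)) / (2 * δ) + 2 * δ := by
  have i1 := (hp.integrable_sq_sqrt_sub_sqrt hq).div_const (2 * δ)
  have i2 := (hp.integrable.fun_add hq.integrable).const_mul δ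
  calc ∫ z, |p z - q z| ∂(α.prod β)
      ≤ ∫ z, ((√(p z) - √(q z)) ^ 2 / (2 * δ) + δ * (p z + q z)) ∂(α.prod β) :=
        integral_mono (hp.integrable.sub hq.integrable).abs (i1.add i2)
          fun z => abs_sub_le_sq_sqrt_sub_sqrt (hp.nonneg z) (hq.nonneg z) hδ
    _ = (∫ z, (√(p z) - √(q z)) ^ 2 ∂(α.prod β)) / (2 * δ) + δ * (1 + 1) := by
        rw [integral_add i1 i2, integral_div, integral_const_mul,
          integral_add hp.integrable hq.integrable, hp.integral_eq_one, hq.integral_eq_one]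
    _ = _ := by ring

variable [IsProbabilityMeasure β]

lemma integrable_mul_add (h : IsPlanDensity c α β p) (ha : Integrable a α)
    (hb : Integrable b β) : Integrable (fun z => p z * (a z.1 + b z.2)) (α.prod β) :=
  h.integrable_mul_iff.2 (integrable_add_of_mem_couplings h.plan_mem_couplings ha hb).1

lemma integral_mul_add (h : IsPlanDensity c α β p) (ha : Integrable a α)
    (hb : Integrable b β) :
    ∫ z, p z * (a z.1 + b z.2) ∂(α.prod β) = ∫ x, a x ∂α + ∫ y, b y ∂β := by
  rw [← h.integral_plan]
  exact (integrable_add_of_mem_couplings h.plan_mem_couplings ha hb).2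

lemma neg_le_integral_mul_cost (h : IsPlanDensity c α β p) (ha : Integrable a α)
    (hb : Integrable b β) (hab : ∀ x y, -(a x + b y) ≤ c (x, y)) :
    -(∫ x, a x ∂α + ∫ y, b y ∂β) ≤ ∫ z, p z * c z ∂(α.prod β) := by
  rw [← h.integral_mul_add ha hb, ← integral_neg]
  refine integral_mono (h.integrable_mul_add ha hb).neg h.cost fun z => ?_
  have := mul_le_mul_of_nonneg_left (hab z.1 z.2) (h.nonneg z)
  rwa [mul_neg] at this

lemma neg_le_densityObjective (hε : 0 ≤ ε) (h : IsPlanDensity c α β p) (ha : Integrable a α)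
    (hb : Integrable b β) (hab : ∀ x y, -(a x + b y) ≤ c (x, y)) :
    -(∫ x, a x ∂α + ∫ y, b y ∂β) ≤ densityObjective c ε α β p :=
  (h.neg_le_integral_mul_cost ha hb hab).trans
    (le_add_of_nonneg_right (mul_nonneg hε h.integral_klFun_nonneg))

/-- The density of the product coupling. -/
lemma one (hc : Integrable c (α.prod β)) : IsPlanDensity c α β fun _ => 1 where
  measurable := measurable_const
  nonneg _ := zero_le_one
  integrable := integrable_const _
  fst A hA := by simp [measureReal_def, ← Set.prod_univ, Measure.prod_prod]
  snd A hA := by simp [measureReal_def, ← Set.univ_prod, Measure.prod_prod]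
  cost := by simpa using hc
  entropy := by simp [klFun_one]

end IsPlanDensity

variable [IsProbabilityMeasure α] [IsProbabilityMeasure β]

/-- Minimizing sequences are Cauchy in `L¹` by uniform convexity, the marginal constraints pass to
the limit in `L¹`, and the objective is lower semicontinuous by Fatou's lemma. -/
lemma exists_minimizing_density (hε : 0 < ε) (hc : Integrable c (α.prod β))
    (ha : Integrable a α) (hb : Integrable b β) (hab : ∀ x y, -(a x + b y) ≤ c (x, y)) :
    ∃ q, IsPlanDensity c α β q ∧ ∀ p, IsPlanDensity c α β p →
      densityObjective c ε α β q ≤ densityObjective c ε α β p := by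
  set S : Set ℝ := {r | ∃ p, IsPlanDensity c α β p ∧ densityObjective c ε α β p = r} with hS
  set A : ℝ := ∫ x, a x ∂α + ∫ y, b y ∂β with hA
  have hne : S.Nonempty := ⟨_, _, one hc, rfl⟩
  have hbdd : BddBelow S := by
    refine ⟨-A, ?_⟩
    rintro _ ⟨p, hp, rfl⟩
    exact hp.neg_le_densityObjective hε.le ha hb hab
  set I := sInf S with hI
  have hIle : ∀ p, IsPlanDensity c α β p → I ≤ densityObjective c ε α β p :=
    fun p hp => csInf_le hbdd ⟨p, hp, rfl⟩
  -- The tolerance is chosen so that consecutive `L¹` distances are summable.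
  set δ : ℕ → ℝ := fun n => (1 / 2) ^ n with hδ
  have hδ0 : ∀ n, 0 < δ n := fun n => by positivity
  have hδanti : Antitone δ := pow_right_anti₀ (by norm_num) (by norm_num)
  have hδlim : Tendsto δ atTop (𝓝 0) :=
    tendsto_pow_atTop_nhds_zero_of_lt_one (by norm_num) (by norm_num)
  have hseq : ∀ n, ∃ p, IsPlanDensity c α β p ∧
      densityObjective c ε α β p < I + ε * δ n ^ 2 / 2 := by
    intro n
    obtain ⟨_, ⟨p, hp, rfl⟩, h⟩ := exists_lt_of_csInf_lt hne
      (show sInf S < I + ε * δ n ^ 2 / 2 by have := hδ0 n; rw [← hI]; simp; positivity)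
    exact ⟨p, hp, h⟩
  choose p hp hpI using hseq
  have hcau : ∀ N n m, N ≤ n → N ≤ m →
      eLpNorm (p n - p m) 1 (α.prod β) < ENNReal.ofReal (4 * δ N) := by
    intro N n m hn hm
    have hN := hδ0 N
    have hsq : ∀ k, N ≤ k → densityObjective c ε α β (p k) ≤ I + ε * δ N ^ 2 / 2 := by
      intro k hk
      have := pow_le_pow_left₀ (hδ0 k).le (hδanti hk) 2
      nlinarith [hpI k]
    have h1 := densityObjective_midpoint_add_le hε.le (hp n) (hp m)
    have h2 := hIle _ ((hp n).midpoint (hp m))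
    have h3 : ∫ z, (√(p n z) - √(p m z)) ^ 2 ∂(α.prod β) ≤ 2 * δ N ^ 2 := by
      have : ε * ∫ z, (√(p n z) - √(p m z)) ^ 2 ∂(α.prod β) ≤ ε * (2 * δ N ^ 2) := by
        linarith [hsq n hn, hsq m hm]
      exact le_of_mul_le_mul_left this hε
    have h4 := (hp n).integral_abs_sub_le (hp m) hN
    have h5 : (∫ z, (√(p n z) - √(p m z)) ^ 2 ∂(α.prod β)) / (2 * δ N) ≤ δ N := by
      rw [div_le_iff₀ (by positivity)]
      linarith
    rw [eLpNorm_one_eq_lintegral_enorm,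
      ← ofReal_integral_norm_eq_lintegral_enorm ((hp n).integrable.sub (hp m).integrable)]
    refine (ENNReal.ofReal_lt_ofReal_iff (by positivity)).2 ?_
    simp only [Pi.sub_apply, Real.norm_eq_abs]
    linarith
  have hB : ∑' n, ENNReal.ofReal (4 * δ n) ≠ ⊤ := by
    rw [← ENNReal.ofReal_tsum_of_nonneg (fun n => by have := hδ0 n; positivity)
      ((summable_geometric_of_lt_one (by norm_num) (by norm_num)).mul_left 4)]
    exact ENNReal.ofReal_ne_top
  have hmeas : ∀ n, AEStronglyMeasurable (p n) (α.prod β) := fun n => (hp n).integrable.1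
  obtain ⟨q', hq'm, hq'⟩ := exists_stronglyMeasurable_limit_of_tendsto_ae hmeas
    (Lp.ae_tendsto_of_cauchy_eLpNorm hmeas le_rfl hB hcau)
  set q : X × X → ℝ := fun z => max (q' z) 0 with hq
  have hqm : Measurable q := hq'm.measurable.max measurable_const
  have hq0 : ∀ z, 0 ≤ q z := fun z => le_max_right _ _
  have hlim : ∀ᵐ z ∂(α.prod β), Tendsto (fun n => p n z) atTop (𝓝 (q z)) := by
    filter_upwards [hq'] with z hz
    rwa [show q z = q' z from max_eq_left (ge_of_tendsto' hz fun n => (hp n).nonneg z)]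
  have hL1 := Lp.cauchy_tendsto_of_tendsto hmeas q hB hcau hlim
  have hqi : Integrable q (α.prod β) :=
    (integrable_and_integral_le_of_tendsto (fun n => (hp n).integrable)
      (fun n => (hp n).nonneg) hlim
      (by simp_rw [fun n => (hp n).integral_eq_one]; exact tendsto_const_nhds)).1
  have hset : ∀ s, Tendsto (fun n => ∫ z in s, p n z ∂(α.prod β)) atTop
      (𝓝 (∫ z in s, q z ∂(α.prod β))) := fun s =>
    tendsto_setIntegral_of_L1' q hqi.1 (Eventually.of_forall fun n => (hp n).integrable) hL1 s
  have hfst : ∀ A, MeasurableSet A → ∫ z in Prod.fst ⁻¹' A, q z ∂(α.prod β) = α.real A :=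
    fun A hA => tendsto_nhds_unique (hset _)
      (by simp_rw [fun n => (hp n).fst A hA]; exact tendsto_const_nhds)
  have hsnd : ∀ A, MeasurableSet A → ∫ z in Prod.snd ⁻¹' A, q z ∂(α.prod β) = β.real A :=
    fun A hA => tendsto_nhds_unique (hset _)
      (by simp_rw [fun n => (hp n).snd A hA]; exact tendsto_const_nhds)
  -- Adding `a ⊕ b`, whose integral is fixed by the marginals, makes the integrand nonnegative.
  set G : (X × X → ℝ) → X × X → ℝ :=
    fun r z => r z * c z + r z * (a z.1 + b z.2) + ε * klFun (r z) with hG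
  have hpos : ∀ r : X × X → ℝ, (∀ z, 0 ≤ r z) → ∀ z, 0 ≤ r z * c z + r z * (a z.1 + b z.2) := by
    intro r hr z
    rw [← mul_add]
    exact mul_nonneg (hr z) (by have := hab z.1 z.2; simp only [Prod.mk.eta] at this; linarith)
  have hGi : ∀ r, IsPlanDensity c α β r → Integrable (G r) (α.prod β) ∧
      ∫ z, G r z ∂(α.prod β) = densityObjective c ε α β r + A := by
    intro r hr
    have i1 := hr.integrable_mul_add ha hb
    have i2 := hr.cost.fun_add i1
    refine ⟨i2.fun_add (hr.entropy.const_mul ε), ?_⟩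
    simp only [hG]
    rw [integral_add i2 (hr.entropy.const_mul ε), integral_add hr.cost i1,
      hr.integral_mul_add ha hb, integral_const_mul, densityObjective]
    ring
  have hobj : Tendsto (fun n => densityObjective c ε α β (p n)) atTop (𝓝 I) := by
    refine tendsto_of_tendsto_of_tendsto_of_le_of_le tendsto_const_nhds
      (h := fun n => I + ε * δ n ^ 2 / 2) ?_ (fun n => hIle _ (hp n)) fun n => (hpI n).le
    have := (((hδlim.pow 2).const_mul ε).div_const 2).const_add I
    simpa using this
  obtain ⟨hGq, hGle⟩ := integrable_and_integral_le_of_tendsto (f := fun n => G (p n)) (g := G q)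
    (I := I + A) (fun n => (hGi _ (hp n)).1)
    (fun n z => add_nonneg (hpos _ (hp n).nonneg z)
      (mul_nonneg hε.le (klFun_nonneg ((hp n).nonneg z))))
    (by
      filter_upwards [hlim] with z hz
      exact ((hz.mul_const _).add (hz.mul_const _)).add
        (((continuous_klFun.tendsto _).comp hz).const_mul ε))
    (by simp_rw [fun n => (hGi _ (hp n)).2]; exact hobj.add_const A)
  have hkl : Integrable (fun z => klFun (q z)) (α.prod β) := by
    refine (hGq.const_mul ε⁻¹).mono' (measurable_klFun.comp hqm).aestronglyMeasurable
      (ae_of_all _ fun z => ?_)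
    rw [Real.norm_of_nonneg (klFun_nonneg (hq0 z)), le_inv_mul_iff₀ hε]
    exact le_add_of_nonneg_left (hpos q hq0 z)
  have h0 : IsPlanDensity (fun _ => 0) α β q := ⟨hqm, hq0, hqi, hfst, hsnd, by simp, hkl⟩
  have hqc : Integrable (fun z => q z * c z) (α.prod β) :=
    ((hGq.sub (hkl.const_mul ε)).sub (h0.integrable_mul_add ha hb)).congr
      (ae_of_all _ fun z => by simp only [hG, Pi.sub_apply]; ring)
  have hqd : IsPlanDensity c α β q := ⟨hqm, hq0, hqi, hfst, hsnd, hqc, hkl⟩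
  refine ⟨q, hqd, fun r hr => le_trans ?_ (hIle r hr)⟩
  rw [(hGi q hqd).2] at hGle
  linarith

lemma existsUnique_isRegOptimal (hε : 0 < ε) (hc : Integrable c (α.prod β))
    (ha : Integrable a α) (hb : Integrable b β) (hab : ∀ x y, -(a x + b y) ≤ c (x, y)) :
    ∃! π, IsRegOptimal c ε α β π := by
  obtain ⟨q, hq, hmin⟩ := exists_minimizing_density hε hc ha hb hab
  refine ⟨plan α β q, ⟨hq.plan_mem_finiteCouplings, fun π hπ => ?_⟩, ?_⟩
  · obtain ⟨p, hp, rfl⟩ := exists_isPlanDensity_of_mem_finiteCouplings hπ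
    rw [hp.regObjective_plan, hq.regObjective_plan]
    exact hmin p hp
  · rintro π ⟨hπ, hopt⟩
    obtain ⟨p, hp, rfl⟩ := exists_isPlanDensity_of_mem_finiteCouplings hπ
    have h1 := hopt _ hq.plan_mem_finiteCouplings
    rw [hp.regObjective_plan, hq.regObjective_plan] at h1
    have h2 := densityObjective_midpoint_add_le hε.le hp hq
    have h3 := hmin _ (hp.midpoint hq)
    have h4 : ∫ z, (√(p z) - √(q z)) ^ 2 ∂(α.prod β) ≤ 0 := by
      by_contra! h
      have := mul_pos (show 0 < ε / 4 by positivity) h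
      linarith
    have h5 := (integral_eq_zero_iff_of_nonneg (fun z => sq_nonneg _)
      (hp.integrable_sq_sqrt_sub_sqrt hq)).1
      (le_antisymm h4 (integral_nonneg fun z => sq_nonneg _))
    refine withDensity_congr_ae ?_
    filter_upwards [h5] with z hz
    have : √(p z) = √(q z) := sub_eq_zero.1 (pow_eq_zero_iff two_ne_zero |>.1 hz)
    rw [(Real.sqrt_inj (hp.nonneg z) (hq.nonneg z)).1 this]

end Minimizer

section Limits

open IsPlanDensity

variable {X : Type*} [MeasurableSpace X]

/-! ### Large regularization -/

variable {c : X × X → ℝ} {ε : ℝ} {α β : Measure X} {a b : X → ℝ}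

lemma densityObjective_one :
    densityObjective c ε α β (fun _ => 1) = ∫ z, c z ∂(α.prod β) := by
  simp [densityObjective, klFun_one]

variable [IsProbabilityMeasure α] [IsProbabilityMeasure β]

lemma exists_density_regCoupling (hε : 0 < ε) (hc : Integrable c (α.prod β))
    (ha : Integrable a α) (hb : Integrable b β) (hab : ∀ x y, -(a x + b y) ≤ c (x, y)) :
    ∃ q, IsPlanDensity c α β q ∧ regCoupling c ε α β = plan α β q ∧
      ∀ p, IsPlanDensity c α β p →
        densityObjective c ε α β q ≤ densityObjective c ε α β p := by
  have hex := (existsUnique_isRegOptimal hε hc ha hb hab).exists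
  have hopt : IsRegOptimal c ε α β (regCoupling c ε α β) := by
    rw [regCoupling, dif_pos hex]
    exact hex.choose_spec
  obtain ⟨q, hq, e⟩ := exists_isPlanDensity_of_mem_finiteCouplings hopt.1
  refine ⟨q, hq, e, fun p hp => ?_⟩
  have := hopt.2 _ hp.plan_mem_finiteCouplings
  rwa [e, hq.regObjective_plan, hp.regObjective_plan] at this

lemma IsPlanDensity.integral_abs_sub_one_le {p : X × X → ℝ} (h : IsPlanDensity c α β p)
    {δ : ℝ} (hδ : 0 < δ) :
    ∫ z, |p z - 1| ∂(α.prod β) ≤ (∫ z, klFun (p z) ∂(α.prod β)) / (2 * δ) + 2 * δ := by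
  have h0 : IsPlanDensity (fun _ => 0) α β p := { h with cost := by simp }
  have h1 : IsPlanDensity (fun _ => 0) α β (fun _ => 1) := one (integrable_const _)
  refine (h0.integral_abs_sub_le h1 hδ).trans ?_
  gcongr
  · exact h0.integrable_sq_sqrt_sub_sqrt h1
  · exact h.entropy
  · intro z
    simpa using sq_sqrt_sub_one_le_klFun (h.nonneg z)

/-- The relative entropy of the optimal coupling is `O(1 / ε)`, so that its density converges to
`1` in `L¹`. -/
lemma tendsto_integral_regCoupling_atTop (hc : Integrable c (α.prod β))
    (ha : Integrable a α) (hb : Integrable b β) (hab : ∀ x y, -(a x + b y) ≤ c (x, y))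
    {f : X × X → ℝ} (hf : AEStronglyMeasurable f (α.prod β)) {M : ℝ} (hM : ∀ z, |f z| ≤ M) :
    Tendsto (fun ε : ℝ => ∫ z, f z ∂(regCoupling c ε α β)) atTop
      (𝓝 (∫ z, f z ∂(α.prod β))) := by
  set B := ∫ z, c z ∂(α.prod β) + (∫ x, a x ∂α + ∫ y, b y ∂β) with hB
  have hlim : Tendsto (fun ε : ℝ => M * ((B / 2 + 2) / √ε)) atTop (𝓝 0) := by
    have := (tendsto_const_nhds (x := B / 2 + 2)).div_atTop Real.tendsto_sqrt_atTop
    simpa using this.const_mul M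
  rw [tendsto_iff_dist_tendsto_zero]
  refine squeeze_zero' (Eventually.of_forall fun _ => dist_nonneg) ?_ hlim
  filter_upwards [eventually_gt_atTop 0] with ε hε
  obtain ⟨q, hq, e, hmin⟩ := exists_density_regCoupling hε hc ha hb hab
  have hfi : Integrable f (α.prod β) := (integrable_const M).mono' hf (ae_of_all _ hM)
  have hqf : Integrable (fun z => q z * f z) (α.prod β) :=
    hq.integrable.mul_bdd hf (ae_of_all _ hM)
  have hkl : ε * ∫ z, klFun (q z) ∂(α.prod β) ≤ B := by
    have h1 := hmin _ (one hc)
    rw [densityObjective_one, densityObjective] at h1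
    have h2 := hq.neg_le_integral_mul_cost ha hb hab
    linarith
  have hs : 0 < √ε := Real.sqrt_pos.2 hε
  have hss : √ε * √ε = ε := Real.mul_self_sqrt hε.le
  have hM0 : 0 ≤ M := (abs_nonneg _).trans (hM (Classical.choice
    (nonempty_of_isProbabilityMeasure (α.prod β))))
  rw [e, hq.integral_plan, Real.dist_eq, ← integral_sub hqf hfi]
  calc |∫ z, (q z * f z - f z) ∂(α.prod β)|
      ≤ ∫ z, |q z * f z - f z| ∂(α.prod β) := abs_integral_le_integral_abs
    _ ≤ ∫ z, M * |q z - 1| ∂(α.prod β) := by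
        refine integral_mono (hqf.sub hfi).abs
          ((hq.integrable.sub (integrable_const 1)).abs.const_mul M) fun z => ?_
        have : q z * f z - f z = f z * (q z - 1) := by ring
        simp only [this, abs_mul]
        exact mul_le_mul_of_nonneg_right (hM z) (abs_nonneg _)
    _ = M * ∫ z, |q z - 1| ∂(α.prod β) := integral_const_mul _ _
    _ ≤ M * ((B / 2 + 2) / √ε) := by
        refine mul_le_mul_of_nonneg_left ?_ hM0
        refine (hq.integral_abs_sub_one_le (inv_pos.2 hs)).trans ?_
        have : ∫ z, klFun (q z) ∂(α.prod β) ≤ B / ε := by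
          rwa [le_div_iff₀ hε, mul_comm]
        calc (∫ z, klFun (q z) ∂(α.prod β)) / (2 * (√ε)⁻¹) + 2 * (√ε)⁻¹
            ≤ B / ε / (2 * (√ε)⁻¹) + 2 * (√ε)⁻¹ := by gcongr
          _ = (B / 2 + 2) / √ε := by
            generalize √ε = s at hs hss
            rw [← hss]
            field_simp

/-- The upper bound compares with the product coupling; the lower bound truncates the
nonnegative function `c + a ⊕ b`. -/
lemma tendsto_regCost_atTop (hc : Integrable c (α.prod β))
    (ha : Integrable a α) (hb : Integrable b β) (hab : ∀ x y, -(a x + b y) ≤ c (x, y)) :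
    Tendsto (fun ε : ℝ => regCost c ε α β) atTop (𝓝 (∫ z, c z ∂(α.prod β))) := by
  obtain ⟨iab, eab⟩ := integrable_add_of_mem_couplings
    (prod_mem_couplings (α := α) (β := β)) ha hb
  set g : X × X → ℝ := fun z => c z + (a z.1 + b z.2) with hg
  have hg0 : ∀ z, 0 ≤ g z := fun z => by
    have := hab z.1 z.2
    simp only [Prod.mk.eta] at this
    simp only [hg]
    linarith
  have hgi : Integrable g (α.prod β) := hc.add iab
  have hgI : ∫ z, g z ∂(α.prod β) =
      ∫ z, c z ∂(α.prod β) + (∫ x, a x ∂α + ∫ y, b y ∂β) := by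
    rw [integral_add hc iab, eab]
  have htr : Tendsto (fun n : ℕ => ∫ z, min (g z) n ∂(α.prod β)) atTop
      (𝓝 (∫ z, g z ∂(α.prod β))) := by
    refine tendsto_integral_of_dominated_convergence g
      (fun n => hgi.1.inf aestronglyMeasurable_const) hgi (fun n => ae_of_all _ fun z => ?_)
      (ae_of_all _ fun z => ?_)
    · rw [Real.norm_of_nonneg (le_min (hg0 z) n.cast_nonneg)]
      exact min_le_left _ _
    · refine tendsto_const_nhds.congr' ?_
      filter_upwards [eventually_ge_atTop ⌈g z⌉₊] with n hn
      exact (min_eq_left ((Nat.le_ceil _).trans (Nat.cast_le.2 hn))).symm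
  rw [tendsto_order]
  constructor
  · intro r hr
    obtain ⟨n, hn⟩ := (htr.eventually_const_lt
      (show r + (∫ x, a x ∂α + ∫ y, b y ∂β) < _ by rw [hgI]; linarith)).exists
    have hmn : AEStronglyMeasurable (fun z => min (g z) (n : ℝ)) (α.prod β) :=
      hgi.1.inf aestronglyMeasurable_const
    have hbn : ∀ z, |min (g z) (n : ℝ)| ≤ n := fun z => by
      rw [abs_of_nonneg (le_min (hg0 z) n.cast_nonneg)]
      exact min_le_right _ _
    filter_upwards [(tendsto_integral_regCoupling_atTop hc ha hb hab hmn hbn).eventually_const_lt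
      hn, eventually_gt_atTop 0] with ε h hε
    obtain ⟨q, hq, e, -⟩ := exists_density_regCoupling hε hc ha hb hab
    rw [regCost, e, hq.integral_plan]
    rw [e, hq.integral_plan] at h
    have iq := hq.integrable_mul_add ha hb
    have : ∫ z, q z * min (g z) n ∂(α.prod β) ≤
        ∫ z, (q z * c z + q z * (a z.1 + b z.2)) ∂(α.prod β) := by
      refine integral_mono (hq.integrable.mul_bdd hmn (ae_of_all _ hbn))
        (hq.cost.fun_add iq) fun z => ?_
      simp only [← mul_add]
      exact mul_le_mul_of_nonneg_left (min_le_left _ _) (hq.nonneg z)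
    rw [integral_add hq.cost iq, hq.integral_mul_add ha hb] at this
    linarith
  · intro r hr
    filter_upwards [eventually_gt_atTop 0] with ε hε
    obtain ⟨q, hq, e, hmin⟩ := exists_density_regCoupling hε hc ha hb hab
    have h1 := hmin _ (one hc)
    rw [densityObjective_one, densityObjective] at h1
    rw [regCost, e, hq.integral_plan]
    have := mul_nonneg hε.le hq.integral_klFun_nonneg
    linarith

/-! ### Small regularization, given approximation by couplings of finite entropy -/

lemma bddBelow_otCost {c : X × X → ℝ} {α β : Measure X} (hc0 : ∀ z, 0 ≤ c z) :
    BddBelow {r : ℝ | ∃ π ∈ couplings α β, Integrable c π ∧ r = ∫ z, c z ∂π} := by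
  refine ⟨0, ?_⟩
  rintro _ ⟨π, -, -, rfl⟩
  exact integral_nonneg hc0

lemma tendsto_regCost_zero (hc : Integrable c (α.prod β)) (hc0 : ∀ z, 0 ≤ c z)
    (happ : ∀ π ∈ couplings α β, Integrable c π → ∀ δ > 0, ∃ p, IsPlanDensity c α β p ∧
      ∫ z, p z * c z ∂(α.prod β) ≤ ∫ z, c z ∂π + δ) :
    Tendsto (fun ε : ℝ => regCost c ε α β) (𝓝[>] 0) (𝓝 (otCost c α β)) := by
  have hab : ∀ x y, -((0 : X → ℝ) x + (0 : X → ℝ) y) ≤ c (x, y) := fun x y => by simp [hc0]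
  have h0α : Integrable (0 : X → ℝ) α := integrable_zero _ _ _
  have h0β : Integrable (0 : X → ℝ) β := integrable_zero _ _ _
  have hpos : ∀ᶠ ε : ℝ in 𝓝[>] 0, 0 < ε := eventually_mem_nhdsWithin
  rw [tendsto_order]
  constructor
  · intro r hr
    filter_upwards [hpos] with ε hε
    obtain ⟨q, hq, e, -⟩ := exists_density_regCoupling hε hc h0α h0β hab
    refine hr.trans_le (csInf_le (bddBelow_otCost hc0) ⟨_, hq.plan_mem_couplings,
      hq.plan_mem_finiteCouplings.2.1, by rw [regCost, e]⟩)
  · intro r hr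
    have hne : {r : ℝ | ∃ π ∈ couplings α β, Integrable c π ∧ r = ∫ z, c z ∂π}.Nonempty :=
      ⟨_, _, prod_mem_couplings, hc, rfl⟩
    obtain ⟨_, ⟨π, hπ, hcπ, rfl⟩, hlt⟩ := exists_lt_of_csInf_lt hne hr
    obtain ⟨p, hp, hple⟩ := happ π hπ hcπ ((r - ∫ z, c z ∂π) / 2) (by linarith)
    have hlim : Tendsto (fun ε : ℝ => densityObjective c ε α β p) (𝓝[>] 0)
        (𝓝 (∫ z, p z * c z ∂(α.prod β))) := by
      have : Continuous fun ε : ℝ => densityObjective c ε α β p := by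
        unfold densityObjective
        fun_prop
      have := this.tendsto 0
      simp only [densityObjective, zero_mul, add_zero] at this
      exact this.mono_left nhdsWithin_le_nhds
    filter_upwards [hpos, hlim.eventually_lt_const (show _ < r by linarith)] with ε hε h
    obtain ⟨q, hq, e, hmin⟩ := exists_density_regCoupling hε hc h0α h0β hab
    have h1 := hmin p hp
    have h2 := mul_nonneg hε.le hq.integral_klFun_nonneg
    rw [regCost, e, hq.integral_plan]
    rw [densityObjective] at h1
    linarith

end Limits

section Completing

open IsPlanDensity

variable {X : Type*} [MeasurableSpace X]

/-! ### Completing a bounded subcoupling to a coupling -/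

variable {c : X × X → ℝ} {α β : Measure X}

section Completion

variable [IsProbabilityMeasure α] [IsProbabilityMeasure β]

lemma isPlanDensity_of_bounded {p : X × X → ℝ} (hp : Measurable p) (h0 : ∀ z, 0 ≤ p z)
    {M : ℝ} (hM : ∀ z, p z ≤ M) (h1 : ∀ x, ∫ y, p (x, y) ∂β = 1)
    (h2 : ∀ y, ∫ x, p (x, y) ∂α = 1) (hc : Integrable c (α.prod β)) :
    IsPlanDensity c α β p := by
  have hb : ∀ z, ‖p z‖ ≤ M := fun z => by rw [Real.norm_of_nonneg (h0 z)]; exact hM z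
  have hi : Integrable p (α.prod β) :=
    (integrable_const M).mono' hp.aestronglyMeasurable (ae_of_all _ hb)
  obtain ⟨C, hC⟩ := isCompact_Icc.exists_bound_of_continuousOn
    (s := Set.Icc 0 M) continuous_klFun.continuousOn
  refine ⟨hp, h0, hi, fun A hA => ?_, fun A hA => ?_,
    hc.bdd_mul hp.aestronglyMeasurable (ae_of_all _ hb),
    (integrable_const C).mono' (measurable_klFun.comp hp).aestronglyMeasurable
      (ae_of_all _ fun z => hC _ ⟨h0 z, hM z⟩)⟩
  · rw [← Set.prod_univ, setIntegral_prod _ hi.integrableOn]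
    simp [h1]
  · rw [← Set.univ_prod, ← Measure.prod_restrict, integral_prod_symm]
    · simp [h2]
    · rw [Measure.prod_restrict]
      exact hi.integrableOn

/-- Splitting an integral against a weight in `[0, 1]` at the level `M` of the cost. -/
lemma integral_mul_le_of_le_one (hc : Integrable c (α.prod β))
    {w : X × X → ℝ} (hw : Measurable w) (hw0 : ∀ z, 0 ≤ w z) (hw1 : ∀ z, w z ≤ 1) (M : ℝ) :
    ∫ z, w z * c z ∂(α.prod β) ≤
      M * ∫ z, w z ∂(α.prod β) + ∫ z, max (c z - M) 0 ∂(α.prod β) := by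
  have hb : ∀ z, ‖w z‖ ≤ 1 := fun z => by rw [Real.norm_of_nonneg (hw0 z)]; exact hw1 z
  have hwi : Integrable w (α.prod β) :=
    (integrable_const 1).mono' hw.aestronglyMeasurable (ae_of_all _ hb)
  have hci : Integrable (fun z => max (c z - M) 0) (α.prod β) :=
    (hc.sub (integrable_const M)).pos_part
  rw [← integral_const_mul, ← integral_add (hwi.const_mul M) hci]
  refine integral_mono (hc.bdd_mul hw.aestronglyMeasurable (ae_of_all _ hb))
    ((hwi.const_mul M).fun_add hci) fun z => ?_
  have h1 : c z - M ≤ max (c z - M) 0 := le_max_left _ _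
  have h2 : 0 ≤ max (c z - M) 0 := le_max_right _ _
  nlinarith [hw0 z, hw1 z, mul_le_mul_of_nonneg_left h1 (hw0 z),
    mul_le_mul_of_nonneg_right (hw1 z) h2]

lemma tendsto_integral_tail (hc : Integrable c (α.prod β)) (hc0 : ∀ z, 0 ≤ c z) :
    Tendsto (fun n : ℕ => ∫ z, max (c z - n) 0 ∂(α.prod β)) atTop (𝓝 0) := by
  have : Tendsto (fun n : ℕ => ∫ z, max (c z - n) 0 ∂(α.prod β)) atTop
      (𝓝 (∫ z, (0 : ℝ) ∂(α.prod β))) := by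
    refine tendsto_integral_of_dominated_convergence c
      (fun n => (hc.sub (integrable_const (n : ℝ))).pos_part.1) hc
      (fun n => ae_of_all _ fun z => ?_) (ae_of_all _ fun z => ?_)
    · rw [Real.norm_of_nonneg (le_max_right _ _)]
      exact max_le (by simp) (hc0 z)
    · refine tendsto_const_nhds.congr' ?_
      filter_upwards [eventually_ge_atTop ⌈c z⌉₊] with n hn
      have := (Nat.le_ceil (c z)).trans (Nat.cast_le.2 hn)
      exact (max_eq_right (by linarith)).symm
  simpa using this

/-- With marginal densities `s`, `t` and mass `m` of the subcoupling `Q`, and `τ = 1 - l`, the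
coupling is `τ Q + (1 - τ s) ⊗ (1 - τ t) / (1 - τ m)`. The factor `τ` keeps the density of the
second term below `1 / l`, so that its cost is controlled by the integrability of `c` alone. -/
lemma exists_completion (hc : Integrable c (α.prod β)) (hc0 : ∀ z, 0 ≤ c z)
    {Q : X × X → ℝ} (hQ : Measurable Q) (hQ0 : ∀ z, 0 ≤ Q z) {K : ℝ} (hK : ∀ z, Q z ≤ K)
    (hs : ∀ x, ∫ y, Q (x, y) ∂β ≤ 1) (ht : ∀ y, ∫ x, Q (x, y) ∂α ≤ 1)
    {l : ℝ} (hl0 : 0 < l) (hl1 : l < 1) (M : ℝ) :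
    ∃ p, IsPlanDensity c α β p ∧ ∫ z, p z * c z ∂(α.prod β) ≤
      ∫ z, Q z * c z ∂(α.prod β) + l * ∫ z, c z ∂(α.prod β) +
        (2 + 1 / l) * (M * (1 - ∫ z, Q z ∂(α.prod β)) + ∫ z, max (c z - M) 0 ∂(α.prod β)) := by
  have hbQ : ∀ z, ‖Q z‖ ≤ K := fun z => by rw [Real.norm_of_nonneg (hQ0 z)]; exact hK z
  have hQi : Integrable Q (α.prod β) :=
    (integrable_const K).mono' hQ.aestronglyMeasurable (ae_of_all _ hbQ)
  have hQx : ∀ x, Integrable (fun y => Q (x, y)) β := fun x =>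
    (integrable_const K).mono' (hQ.comp measurable_prodMk_left).aestronglyMeasurable
      (ae_of_all _ fun _ => hbQ _)
  have hQy : ∀ y, Integrable (fun x => Q (x, y)) α := fun y =>
    (integrable_const K).mono' (hQ.comp measurable_prodMk_right).aestronglyMeasurable
      (ae_of_all _ fun _ => hbQ _)
  set s : X → ℝ := fun x => ∫ y, Q (x, y) ∂β with hsdef
  set t : X → ℝ := fun y => ∫ x, Q (x, y) ∂α with htdef
  set m : ℝ := ∫ z, Q z ∂(α.prod β) with hm
  have hsm : Measurable s := hQ.stronglyMeasurable.integral_prod_right'.measurable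
  have htm : Measurable t := hQ.stronglyMeasurable.integral_prod_left'.measurable
  have hs0 : ∀ x, 0 ≤ s x := fun x => integral_nonneg fun y => hQ0 _
  have ht0 : ∀ x, 0 ≤ t x := fun x => integral_nonneg fun y => hQ0 _
  have his : Integrable s α := (integrable_const (1 : ℝ)).mono' hsm.aestronglyMeasurable
    (ae_of_all _ fun x => by rw [Real.norm_of_nonneg (hs0 x)]; exact hs x)
  have hit : Integrable t β := (integrable_const (1 : ℝ)).mono' htm.aestronglyMeasurable
    (ae_of_all _ fun x => by rw [Real.norm_of_nonneg (ht0 x)]; exact ht x)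
  have hsI : ∫ x, s x ∂α = m := (integral_prod Q hQi).symm
  have htI : ∫ y, t y ∂β = m := (integral_prod_symm Q hQi).symm
  have hm1 : m ≤ 1 := by
    rw [← hsI]
    simpa using integral_mono his (integrable_const (1 : ℝ)) hs
  have hD : l ≤ 1 - (1 - l) * m := by nlinarith
  have hD0 : 0 < 1 - (1 - l) * m := hl0.trans_le hD
  set r : X × X → ℝ :=
    fun z => (1 - (1 - l) * s z.1) * (1 - (1 - l) * t z.2) / (1 - (1 - l) * m) with hr
  have hus : ∀ x, 0 ≤ 1 - (1 - l) * s x := fun x => by nlinarith [hs x, hs0 x]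
  have hut : ∀ x, 0 ≤ 1 - (1 - l) * t x := fun x => by nlinarith [ht x, ht0 x]
  have hus1 : ∀ x, 1 - (1 - l) * s x ≤ 1 := fun x => by nlinarith [hs x, hs0 x]
  have hut1 : ∀ x, 1 - (1 - l) * t x ≤ 1 := fun x => by nlinarith [ht x, ht0 x]
  have hr0 : ∀ z, 0 ≤ r z := fun z => div_nonneg (mul_nonneg (hus _) (hut _)) hD0.le
  have hr1 : ∀ z, r z ≤ 1 / l := fun z =>
    div_le_div₀ zero_le_one (mul_le_one₀ (hus1 _) (hut _) (hut1 _)) hl0 hD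
  have hrm : Measurable r := by fun_prop
  have hbr : ∀ z, ‖r z‖ ≤ 1 / l := fun z => by rw [Real.norm_of_nonneg (hr0 z)]; exact hr1 z
  have hrx : ∀ x, Integrable (fun y => r (x, y)) β := fun x =>
    (integrable_const (1 / l)).mono' (hrm.comp measurable_prodMk_left).aestronglyMeasurable
      (ae_of_all _ fun _ => hbr _)
  have hry : ∀ y, Integrable (fun x => r (x, y)) α := fun y =>
    (integrable_const (1 / l)).mono' (hrm.comp measurable_prodMk_right).aestronglyMeasurable
      (ae_of_all _ fun _ => hbr _)
  have hp : IsPlanDensity c α β fun z => (1 - l) * Q z + r z := by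
    refine isPlanDensity_of_bounded (by fun_prop)
      (fun z => add_nonneg (mul_nonneg (by linarith) (hQ0 z)) (hr0 z))
      (M := (1 - l) * K + 1 / l)
      (fun z => add_le_add (mul_le_mul_of_nonneg_left (hK z) (by linarith)) (hr1 z))
      (fun x => ?_) (fun y => ?_) hc
    · rw [integral_add ((hQx x).const_mul _) (hrx x), integral_const_mul]
      simp only [hr]
      rw [integral_div, integral_const_mul, integral_sub (integrable_const _)
        (hit.const_mul _), integral_const_mul, htI]
      simp only [integral_const, probReal_univ, smul_eq_mul, one_mul]
      rw [mul_div_cancel_right₀ _ hD0.ne']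
      ring
    · rw [integral_add ((hQy y).const_mul _) (hry y), integral_const_mul]
      simp only [hr]
      rw [integral_div, integral_mul_const, integral_sub (integrable_const _)
        (his.const_mul _), integral_const_mul, hsI]
      simp only [integral_const, probReal_univ, smul_eq_mul, one_mul]
      rw [mul_div_cancel_left₀ _ hD0.ne']
      ring
  refine ⟨_, hp, ?_⟩
  have hQc : Integrable (fun z => Q z * c z) (α.prod β) :=
    hc.bdd_mul hQ.aestronglyMeasurable (ae_of_all _ hbQ)
  have hw : ∀ (w : X × X → ℝ), Measurable w → (∀ z, 0 ≤ w z) → (∀ z, w z ≤ 1) →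
      Integrable (fun z => w z * c z) (α.prod β) := fun w h h0 h1 =>
    hc.bdd_mul (c := 1) h.aestronglyMeasurable
      (ae_of_all _ fun z => by rw [Real.norm_of_nonneg (h0 z)]; exact h1 z)
  have hsm' : Measurable fun z : X × X => 1 - s z.1 := by fun_prop
  have htm' : Measurable fun z : X × X => 1 - t z.2 := by fun_prop
  have is := hw (fun z => 1 - s z.1) hsm' (fun z => by linarith [hs z.1])
    (fun z => by linarith [hs0 z.1])
  have it := hw (fun z => 1 - t z.2) htm' (fun z => by linarith [ht z.2])
    (fun z => by linarith [ht0 z.2])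
  have bs := integral_mul_le_of_le_one hc hsm' (fun z => by linarith [hs z.1])
    (fun z => by linarith [hs0 z.1]) M
  have bt := integral_mul_le_of_le_one hc htm' (fun z => by linarith [ht z.2])
    (fun z => by linarith [ht0 z.2]) M
  have es : ∫ z : X × X, (1 - s z.1) ∂(α.prod β) = 1 - m := by
    rw [integral_fun_fst (fun x => 1 - s x), integral_sub (integrable_const _) his, hsI]
    simp
  have et : ∫ z : X × X, (1 - t z.2) ∂(α.prod β) = 1 - m := by
    rw [integral_fun_snd (fun x => 1 - t x), integral_sub (integrable_const _) hit, htI]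
    simp
  rw [es] at bs
  rw [et] at bt
  -- Enlarge `1 - (1 - l) s` to `l + (1 - s)`, likewise for `t`, and use `1 - s ≤ 1` in the product.
  have hrle : ∀ z, r z ≤ l + (1 - s z.1) + (1 + 1 / l) * (1 - t z.2) := by
    intro z
    have h1 : r z ≤ (l + (1 - s z.1)) * (l + (1 - t z.2)) / l := by
      have := hs0 z.1
      have := ht0 z.2
      have := hs z.1
      have := ht z.2
      refine div_le_div₀ (mul_nonneg (by linarith) (by linarith)) (mul_le_mul ?_ ?_ (hut _)
        (by linarith)) hl0 hD <;> nlinarith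
    refine h1.trans ?_
    have h2 : (1 - s z.1) * (1 - t z.2) ≤ 1 - t z.2 :=
      mul_le_of_le_one_left (by linarith [ht z.2]) (by linarith [hs0 z.1])
    rw [div_le_iff₀ hl0]
    have : (l + (1 - s z.1) + (1 + 1 / l) * (1 - t z.2)) * l =
      l * l + (1 - s z.1) * l + (l + 1) * (1 - t z.2) := by field_simp
    nlinarith
  calc ∫ z, ((1 - l) * Q z + r z) * c z ∂(α.prod β)
      ≤ ∫ z, (Q z * c z + l * c z + (1 - s z.1) * c z +
          (1 + 1 / l) * ((1 - t z.2) * c z)) ∂(α.prod β) := by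
        refine integral_mono hp.cost (((hQc.fun_add (hc.const_mul l)).fun_add is).fun_add
          (it.const_mul _)) fun z => ?_
        have := mul_le_mul_of_nonneg_right (hrle z) (hc0 z)
        nlinarith [mul_nonneg hl0.le (mul_nonneg (hQ0 z) (hc0 z))]
    _ = ∫ z, Q z * c z ∂(α.prod β) + l * ∫ z, c z ∂(α.prod β) +
          ∫ z, (1 - s z.1) * c z ∂(α.prod β) +
          (1 + 1 / l) * ∫ z, (1 - t z.2) * c z ∂(α.prod β) := by
        rw [integral_add ((hQc.fun_add (hc.const_mul l)).fun_add is) (it.const_mul _),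
          integral_add (hQc.fun_add (hc.const_mul l)) is, integral_add hQc (hc.const_mul l),
          integral_const_mul, integral_const_mul]
    _ ≤ _ := by
        have := mul_le_mul_of_nonneg_left bt (show 0 ≤ 1 + 1 / l by positivity)
        linarith

/-- A bounded subcoupling of nearly full mass extends to a coupling of finite entropy, at nearly
the same cost. -/
lemma exists_isPlanDensity_of_subcoupling (hc : Integrable c (α.prod β)) (hc0 : ∀ z, 0 ≤ c z)
    {δ : ℝ} (hδ : 0 < δ) :
    ∃ η > 0, ∀ Q : X × X → ℝ, Measurable Q → (∀ z, 0 ≤ Q z) → (∃ K, ∀ z, Q z ≤ K) →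
      (∀ x, ∫ y, Q (x, y) ∂β ≤ 1) → (∀ y, ∫ x, Q (x, y) ∂α ≤ 1) →
      1 - η ≤ ∫ z, Q z ∂(α.prod β) →
      ∃ p, IsPlanDensity c α β p ∧
        ∫ z, p z * c z ∂(α.prod β) ≤ ∫ z, Q z * c z ∂(α.prod β) + δ := by
  set C := ∫ z, c z ∂(α.prod β) with hC
  have hC0 : 0 ≤ C := integral_nonneg hc0
  set l : ℝ := min (1 / 2) (δ / (3 * (C + 1))) with hl
  have hl0 : 0 < l := lt_min (by norm_num) (by positivity)
  have hl1 : l < 1 := (min_le_left _ _).trans_lt (by norm_num)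
  have hlC : l * C ≤ δ / 3 := by
    have : l ≤ δ / (3 * (C + 1)) := min_le_right _ _
    rw [le_div_iff₀ (by positivity)] at this
    nlinarith
  set D := 2 + 1 / l with hD
  have hD0 : 0 < D := by positivity
  obtain ⟨n, hn⟩ := ((tendsto_integral_tail hc hc0).eventually_lt_const
    (show 0 < δ / 3 / D by positivity)).exists
  rw [lt_div_iff₀ hD0] at hn
  refine ⟨δ / (3 * D * (n + 1)), by positivity, ?_⟩
  intro Q hQ hQ0 ⟨K, hK⟩ hs ht hm
  obtain ⟨p, hp, h⟩ := exists_completion hc hc0 hQ hQ0 hK hs ht hl0 hl1 n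
  refine ⟨p, hp, h.trans ?_⟩
  have h1 : D * (n * (1 - ∫ z, Q z ∂(α.prod β))) ≤ δ / 3 := by
    have h2 : 1 - ∫ z, Q z ∂(α.prod β) ≤ δ / (3 * D * (n + 1)) := by linarith
    calc D * (n * (1 - ∫ z, Q z ∂(α.prod β))) ≤ D * (n * (δ / (3 * D * (n + 1)))) := by gcongr
      _ = δ / 3 * (n / (n + 1)) := by field_simp
      _ ≤ δ / 3 := mul_le_of_le_one_right (by positivity)
          ((div_le_one (by positivity)).2 (by linarith))
  linarith

end Completion

end Completing

section Blocks

open IsPlanDensity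

/-! ### Block approximation of a coupling -/

/-- A compact set is partitioned by which balls of a finite cover contain a given point. -/
lemma exists_finite_partition {X : Type*} [PseudoMetricSpace X] [MeasurableSpace X]
    [OpensMeasurableSpace X] {K : Set X} (hK : IsCompact K) (hKm : MeasurableSet K) {r : ℝ}
    (hr : 0 < r) :
    ∃ T : Finset (Set X), (∀ A ∈ T, MeasurableSet A) ∧ (T : Set (Set X)).PairwiseDisjoint id ∧
      (⋃ A ∈ T, A) = K ∧ ∀ A ∈ T, ∀ x ∈ A, ∀ y ∈ A, dist x y < r := by
  classical
  obtain ⟨t, -, htf, hcov⟩ := hK.finite_cover_balls (half_pos hr)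
  lift t to Finset X using htf
  set f : X → Finset X := fun x => t.filter fun i => x ∈ Metric.ball i (r / 2) with hf
  have hfm : ∀ u, MeasurableSet {x | f x = u} := by
    intro u
    by_cases hu : u ⊆ t
    · have : {x | f x = u} = ⋂ i ∈ t, {x | x ∈ Metric.ball i (r / 2) ↔ i ∈ u} := by
        ext x
        simp only [hf, Finset.ext_iff, Finset.mem_filter, Set.mem_ofPred_eq, Set.mem_iInter]
        exact ⟨fun h i hi => by simpa [hi] using h i, fun h i =>
          ⟨fun hi => (h i hi.1).1 hi.2, fun hi => ⟨hu hi, (h i (hu hi)).2 hi⟩⟩⟩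
      rw [this]
      refine Finset.measurableSet_biInter _ fun i _ => ?_
      by_cases hi : i ∈ u
      · convert! (Metric.isOpen_ball (x := i) (ε := r / 2)).measurableSet using 1
        ext x
        simp [hi]
      · convert! (Metric.isOpen_ball (x := i) (ε := r / 2)).measurableSet.compl using 1
        ext x
        simp [hi]
    · convert! MeasurableSet.empty
      ext x
      simp only [Set.mem_ofPred_eq, Set.mem_empty_iff_false, iff_false]
      rintro rfl
      exact hu (Finset.filter_subset _ _)
  refine ⟨t.powerset.image fun u => K ∩ {x | f x = u}, ?_, ?_, ?_, ?_⟩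
  · simp only [Finset.mem_image]
    rintro _ ⟨u, -, rfl⟩
    exact hKm.inter (hfm u)
  · intro A hA B hB hAB
    simp only [Finset.coe_image, Set.mem_image] at hA hB
    obtain ⟨u, -, rfl⟩ := hA
    obtain ⟨v, -, rfl⟩ := hB
    refine Set.disjoint_left.2 fun x hx hy => hAB ?_
    rw [← hx.2, ← hy.2]
  · ext x
    simp only [Finset.mem_image, Finset.mem_powerset, Set.mem_iUnion, exists_prop]
    constructor
    · rintro ⟨_, ⟨u, -, rfl⟩, h⟩
      exact h.1
    · exact fun hx => ⟨_, ⟨f x, Finset.filter_subset _ _, rfl⟩, hx, rfl⟩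
  · simp only [Finset.mem_image]
    rintro _ ⟨u, -, rfl⟩ x ⟨hx, hxu⟩ y ⟨hy, hyu⟩
    obtain ⟨i, hi, hxi⟩ := Set.mem_iUnion₂.1 (hcov hx)
    have hiu : i ∈ f y := by
      rw [show f y = f x from hyu.trans hxu.symm]
      exact Finset.mem_filter.2 ⟨hi, hxi⟩
    have hyi := (Finset.mem_filter.1 hiu).2
    rw [Metric.mem_ball] at hxi hyi
    linarith [dist_triangle_right x y i]

/-- Summing row weights against the indicators of disjoint sets selects at most one row. -/
lemma sum_indicator_le_one {X : Type*} {T : Finset (Set X)}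
    (hT : (T : Set (Set X)).PairwiseDisjoint id)
    {w : Set X → ℝ} (hw : ∀ A ∈ T, w A ≤ 1) (x : X) :
    ∑ A ∈ T, A.indicator 1 x * w A ≤ 1 := by
  by_cases h : ∃ A ∈ T, x ∈ A
  · obtain ⟨A, hA, hx⟩ := h
    rw [Finset.sum_eq_single_of_mem A hA]
    · simpa [hx] using hw A hA
    · intro B hB hBA
      have : x ∉ B := fun hxB => Set.disjoint_left.1 (hT hB hA hBA) hxB hx
      simp [this]
  · rw [Finset.sum_eq_zero]
    · exact zero_le_one
    · intro A hA
      have : x ∉ A := fun hx => h ⟨A, hA, hx⟩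
      simp [this]

lemma pairwiseDisjoint_product {X : Type*} {T : Finset (Set X)}
    (hT : (T : Set (Set X)).PairwiseDisjoint id) :
    ((T ×ˢ T : Finset (Set X × Set X)) : Set (Set X × Set X)).Pairwise
      (Function.onFun Disjoint fun W => W.1 ×ˢ W.2) := by
  intro V hV W hW hVW
  simp only [Finset.coe_product, Set.mem_prod] at hV hW
  rw [Function.onFun, Set.disjoint_prod]
  by_contra! h
  refine hVW (Prod.ext ?_ ?_)
  · by_contra h'
    exact h.1 (hT hV.1 hW.1 h')
  · by_contra h'
    exact h.2 (hT hV.2 hW.2 h')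

variable {X : Type*} [MeasurableSpace X]

/-- The mass that `π` gives to the block `A ×ˢ B`, per unit of `α ⊗ β`-mass. It vanishes (by the
convention on division by zero) for blocks that are null for `α ⊗ β`. -/
noncomputable def blockWeight (α β : Measure X) (π : Measure (X × X)) (W : Set X × Set X) : ℝ :=
  π.real (W.1 ×ˢ W.2) / (α.real W.1 * β.real W.2)

/-- The density that averages `π` over the blocks `A ×ˢ B` with `A, B ∈ T`. -/
noncomputable def blockDensity (α β : Measure X) (π : Measure (X × X)) (T : Finset (Set X))
    (z : X × X) : ℝ :=
  ∑ W ∈ T ×ˢ T, blockWeight α β π W * (W.1 ×ˢ W.2).indicator 1 z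

section Block

variable {c : X × X → ℝ} {α β : Measure X} {π : Measure (X × X)} {T : Finset (Set X)}

lemma blockWeight_nonneg (W : Set X × Set X) : 0 ≤ blockWeight α β π W := by
  unfold blockWeight; positivity

lemma blockDensity_nonneg (z : X × X) : 0 ≤ blockDensity α β π T z :=
  Finset.sum_nonneg fun W _ => mul_nonneg (blockWeight_nonneg W)
    (Set.indicator_nonneg (fun _ _ => zero_le_one) _)

lemma blockDensity_le (z : X × X) :
    blockDensity α β π T z ≤ ∑ W ∈ T ×ˢ T, blockWeight α β π W :=
  Finset.sum_le_sum fun W _ => mul_le_of_le_one_right (blockWeight_nonneg W)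
    (Set.indicator_le_self' (fun _ _ => zero_le_one) _)

lemma measurable_blockDensity (hT : ∀ A ∈ T, MeasurableSet A) :
    Measurable (blockDensity α β π T) := by
  refine Finset.measurable_sum _ fun W hW => ?_
  rw [Finset.mem_product] at hW
  exact (measurable_one.indicator ((hT _ hW.1).prod (hT _ hW.2))).const_mul _

lemma integral_blockDensity_mul (hT : ∀ A ∈ T, MeasurableSet A)
    (hc : Integrable c (α.prod β)) :
    ∫ z, blockDensity α β π T z * c z ∂(α.prod β) =
      ∑ W ∈ T ×ˢ T, blockWeight α β π W * ∫ z in W.1 ×ˢ W.2, c z ∂(α.prod β) := by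
  have hm : ∀ W ∈ T ×ˢ T, MeasurableSet (W.1 ×ˢ W.2) := fun W hW => by
    rw [Finset.mem_product] at hW
    exact (hT _ hW.1).prod (hT _ hW.2)
  have e : ∀ z, blockDensity α β π T z * c z =
      ∑ W ∈ T ×ˢ T, blockWeight α β π W * (W.1 ×ˢ W.2).indicator c z := by
    intro z
    rw [blockDensity, Finset.sum_mul]
    refine Finset.sum_congr rfl fun W _ => ?_
    rw [mul_assoc]
    congr 1
    by_cases hz : z ∈ W.1 ×ˢ W.2
    · rw [Set.indicator_of_mem hz, Set.indicator_of_mem hz, Pi.one_apply, one_mul]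
    · rw [Set.indicator_of_notMem hz, Set.indicator_of_notMem hz, zero_mul]
  simp_rw [e]
  rw [integral_finsetSum _ fun W hW => (hc.indicator (hm W hW)).const_mul _]
  refine Finset.sum_congr rfl fun W hW => ?_
  rw [integral_const_mul, integral_indicator (hm W hW)]

variable [IsProbabilityMeasure α]

lemma real_prod_le_left (hπ : π ∈ couplings α β) {A B : Set X} (hA : MeasurableSet A) :
    π.real (A ×ˢ B) ≤ α.real A := by
  have := isProbabilityMeasure_of_mem_couplings hπ
  rw [← hπ.1, map_measureReal_apply measurable_fst hA]
  exact measureReal_mono fun z hz => hz.1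

lemma real_prod_le_right (hπ : π ∈ couplings α β) {A B : Set X} (hB : MeasurableSet B) :
    π.real (A ×ˢ B) ≤ β.real B := by
  have := isProbabilityMeasure_of_mem_couplings hπ
  rw [← hπ.2, map_measureReal_apply measurable_snd hB]
  exact measureReal_mono fun z hz => hz.2

lemma blockWeight_mul (hπ : π ∈ couplings α β) {W : Set X × Set X} (h1 : MeasurableSet W.1)
    (h2 : MeasurableSet W.2) :
    blockWeight α β π W * (α.real W.1 * β.real W.2) = π.real (W.1 ×ˢ W.2) := by
  have hle1 := real_prod_le_left hπ (B := W.2) h1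
  have hle2 := real_prod_le_right hπ (A := W.1) h2
  have h0 : 0 ≤ π.real (W.1 ×ˢ W.2) := measureReal_nonneg
  refine div_mul_cancel_of_imp fun h => ?_
  rcases mul_eq_zero.1 h with h | h <;> linarith

lemma integral_blockDensity_right_le_one (hπ : π ∈ couplings α β)
    (hT : ∀ A ∈ T, MeasurableSet A) (hTd : (T : Set (Set X)).PairwiseDisjoint id) (y : X) :
    ∫ x, blockDensity α β π T (x, y) ∂α ≤ 1 := by
  have := isProbabilityMeasure_of_mem_couplings hπ
  have hi : ∀ W ∈ T ×ˢ T, Integrable (fun x => blockWeight α β π W *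
      (W.1.indicator 1 x * W.2.indicator 1 y)) α := fun W hW =>
    (((integrable_const (1 : ℝ)).indicator (hT _ (Finset.mem_product.1 hW).1)).mul_const
      _).const_mul _
  have e : ∫ x, blockDensity α β π T (x, y) ∂α =
      ∑ B ∈ T, B.indicator 1 y * ∑ A ∈ T, blockWeight α β π (A, B) * α.real A := by
    simp only [blockDensity, Set.indicator_prod_one]
    rw [integral_finsetSum _ hi, Finset.sum_product_right]
    refine Finset.sum_congr rfl fun B _ => ?_
    rw [Finset.mul_sum]
    refine Finset.sum_congr rfl fun A hA => ?_
    rw [integral_const_mul, integral_mul_const, integral_indicator_one (hT A hA)]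
    ring
  rw [e]
  refine sum_indicator_le_one hTd (fun B hB => ?_) y
  have h1 : (∑ A ∈ T, blockWeight α β π (A, B) * α.real A) * β.real B ≤ β.real B := by
    calc (∑ A ∈ T, blockWeight α β π (A, B) * α.real A) * β.real B
        = ∑ A ∈ T, π.real (A ×ˢ B) := by
          rw [Finset.sum_mul]
          refine Finset.sum_congr rfl fun A hA => ?_
          rw [← blockWeight_mul hπ (W := (A, B)) (hT A hA) (hT B hB)]
          ring
      _ = π.real (⋃ A ∈ T, A ×ˢ B) := by
          rw [measureReal_biUnion_finset]
          · exact fun A hA C hC h => Set.disjoint_prod.2 (Or.inl (hTd hA hC h))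
          · exact fun A hA => (hT A hA).prod (hT B hB)
      _ ≤ π.real (Set.univ ×ˢ B) :=
          measureReal_mono (Set.iUnion₂_subset fun A _ => Set.prod_mono_left (Set.subset_univ A))
      _ ≤ β.real B := real_prod_le_right hπ (hT B hB)
  rcases (measureReal_nonneg (μ := β) (s := B)).eq_or_lt with h0 | h0
  · simp [blockWeight, ← h0]
  · exact le_of_mul_le_mul_right (by rwa [one_mul]) h0

variable [IsProbabilityMeasure β]

lemma integral_blockDensity_left_le_one (hπ : π ∈ couplings α β)
    (hT : ∀ A ∈ T, MeasurableSet A) (hTd : (T : Set (Set X)).PairwiseDisjoint id) (x : X) :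
    ∫ y, blockDensity α β π T (x, y) ∂β ≤ 1 := by
  have := isProbabilityMeasure_of_mem_couplings hπ
  have hi : ∀ W ∈ T ×ˢ T, Integrable (fun y => blockWeight α β π W *
      (W.1.indicator 1 x * W.2.indicator 1 y)) β := fun W hW =>
    (((integrable_const (1 : ℝ)).indicator (hT _ (Finset.mem_product.1 hW).2)).const_mul
      _).const_mul _
  have e : ∫ y, blockDensity α β π T (x, y) ∂β =
      ∑ A ∈ T, A.indicator 1 x * ∑ B ∈ T, blockWeight α β π (A, B) * β.real B := by
    simp only [blockDensity, Set.indicator_prod_one]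
    rw [integral_finsetSum _ hi, Finset.sum_product]
    refine Finset.sum_congr rfl fun A _ => ?_
    rw [Finset.mul_sum]
    refine Finset.sum_congr rfl fun B hB => ?_
    rw [integral_const_mul, integral_const_mul, integral_indicator_one (hT B hB)]
    ring
  rw [e]
  refine sum_indicator_le_one hTd (fun A hA => ?_) x
  have h1 : (∑ B ∈ T, blockWeight α β π (A, B) * β.real B) * α.real A ≤ α.real A := by
    calc (∑ B ∈ T, blockWeight α β π (A, B) * β.real B) * α.real A
        = ∑ B ∈ T, π.real (A ×ˢ B) := by
          rw [Finset.sum_mul]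
          refine Finset.sum_congr rfl fun B hB => ?_
          rw [← blockWeight_mul hπ (W := (A, B)) (hT A hA) (hT B hB)]
          ring
      _ = π.real (⋃ B ∈ T, A ×ˢ B) := by
          rw [measureReal_biUnion_finset]
          · exact fun B hB C hC h => Set.disjoint_prod.2 (Or.inr (hTd hB hC h))
          · exact fun B hB => (hT A hA).prod (hT B hB)
      _ ≤ π.real (A ×ˢ Set.univ) :=
          measureReal_mono (Set.iUnion₂_subset fun B _ => Set.prod_mono_right (Set.subset_univ B))
      _ ≤ α.real A := real_prod_le_left hπ (hT A hA)
  rcases (measureReal_nonneg (μ := α) (s := A)).eq_or_lt with h0 | h0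
  · simp [blockWeight, ← h0]
  · exact le_of_mul_le_mul_right (by rwa [one_mul]) h0

lemma integral_blockDensity (hπ : π ∈ couplings α β) (hT : ∀ A ∈ T, MeasurableSet A)
    (hTd : (T : Set (Set X)).PairwiseDisjoint id) :
    ∫ z, blockDensity α β π T z ∂(α.prod β) = π.real (⋃ W ∈ T ×ˢ T, W.1 ×ˢ W.2) := by
  have := isProbabilityMeasure_of_mem_couplings hπ
  have h := integral_blockDensity_mul (π := π) hT (integrable_const (μ := α.prod β) (1 : ℝ))
  simp only [mul_one] at h
  rw [h, measureReal_biUnion_finset (pairwiseDisjoint_product hTd)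
    fun W hW => (hT _ (Finset.mem_product.1 hW).1).prod (hT _ (Finset.mem_product.1 hW).2)]
  refine Finset.sum_congr rfl fun W hW => ?_
  rw [Finset.mem_product] at hW
  rw [← blockWeight_mul hπ (hT _ hW.1) (hT _ hW.2)]
  simp [measureReal_prod_prod]

lemma integral_blockDensity_mul_le (hπ : π ∈ couplings α β) (hT : ∀ A ∈ T, MeasurableSet A)
    (hTd : (T : Set (Set X)).PairwiseDisjoint id) (hc : Integrable c (α.prod β))
    (hc0 : ∀ z, 0 ≤ c z) (hcπ : Integrable c π) {δ : ℝ} (hδ : 0 ≤ δ)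
    (hosc : ∀ W ∈ T ×ˢ T, ∀ z ∈ W.1 ×ˢ W.2, ∀ z' ∈ W.1 ×ˢ W.2, c z ≤ c z' + δ) :
    ∫ z, blockDensity α β π T z * c z ∂(α.prod β) ≤ ∫ z, c z ∂π + δ := by
  have := isProbabilityMeasure_of_mem_couplings hπ
  have hm : ∀ W ∈ T ×ˢ T, MeasurableSet (W.1 ×ˢ W.2) := fun W hW =>
    (hT _ (Finset.mem_product.1 hW).1).prod (hT _ (Finset.mem_product.1 hW).2)
  have hcδ : Integrable (fun z => c z + δ) π := hcπ.add (integrable_const δ)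
  rw [integral_blockDensity_mul hT hc]
  calc ∑ W ∈ T ×ˢ T, blockWeight α β π W * ∫ z in W.1 ×ˢ W.2, c z ∂(α.prod β)
      ≤ ∑ W ∈ T ×ˢ T, ∫ z in W.1 ×ˢ W.2, (c z + δ) ∂π := by
        refine Finset.sum_le_sum fun W hW => ?_
        have hpt : ∀ z ∈ W.1 ×ˢ W.2,
            c z * π.real (W.1 ×ˢ W.2) ≤ ∫ z' in W.1 ×ˢ W.2, (c z' + δ) ∂π := by
          intro z hz
          have := setIntegral_mono_on (μ := π) (f := fun _ => c z)
            (integrable_const _).integrableOn hcδ.integrableOn (hm W hW) (hosc W hW z hz)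
          rwa [setIntegral_const, smul_eq_mul, mul_comm] at this
        set ρ := (α.prod β).real (W.1 ×ˢ W.2) with hρ
        have hρ' : ρ = α.real W.1 * β.real W.2 := measureReal_prod_prod _ _
        have hint : (∫ z in W.1 ×ˢ W.2, c z ∂(α.prod β)) * π.real (W.1 ×ˢ W.2) ≤
            (∫ z' in W.1 ×ˢ W.2, (c z' + δ) ∂π) * ρ := by
          have := setIntegral_mono_on (μ := α.prod β)
            (hc.mul_const (π.real (W.1 ×ˢ W.2))).integrableOn
            (integrable_const (∫ z' in W.1 ×ˢ W.2, (c z' + δ) ∂π)).integrableOn (hm W hW) hpt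
          rwa [setIntegral_const, integral_mul_const, smul_eq_mul, mul_comm ((α.prod β).real _)]
            at this
        rcases (show 0 ≤ ρ from measureReal_nonneg).eq_or_lt with h0 | h0
        · rw [blockWeight, ← hρ', ← h0, div_zero, zero_mul]
          exact integral_nonneg fun z => add_nonneg (hc0 z) hδ
        · rw [blockWeight, ← hρ', div_mul_eq_mul_div, div_le_iff₀ h0, mul_comm (π.real _)]
          exact hint
    _ = ∫ z in ⋃ W ∈ T ×ˢ T, W.1 ×ˢ W.2, (c z + δ) ∂π :=
        (integral_biUnion_finset _ hm (pairwiseDisjoint_product hTd)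
          fun W _ => hcδ.integrableOn).symm
    _ ≤ ∫ z, (c z + δ) ∂π :=
        setIntegral_le_integral hcδ (ae_of_all _ fun z => add_nonneg (hc0 z) hδ)
    _ = ∫ z, c z ∂π + δ := by
        rw [integral_add hcπ (integrable_const δ)]
        simp

end Block

/-! ### Couplings of Radon measures -/

section Radon

variable {X : Type*} [MetricSpace X] [MeasurableSpace X] [BorelSpace X] {α β : Measure X}
  [IsProbabilityMeasure α] [IsProbabilityMeasure β] [α.InnerRegular] [β.InnerRegular]

lemma exists_isCompact_measure_compl_lt {η : ℝ} (hη : 0 < η) :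
    ∃ K : Set X, IsCompact K ∧ ∀ π ∈ couplings α β, π.real (K ×ˢ K)ᶜ < η := by
  have hη' : ENNReal.ofReal (η / 2) ≠ 0 := by simpa using hη
  obtain ⟨K, -, hK, hKα⟩ := MeasurableSet.univ.exists_isCompact_sdiff_lt (measure_ne_top α _) hη'
  obtain ⟨L, -, hL, hLβ⟩ := MeasurableSet.univ.exists_isCompact_sdiff_lt (measure_ne_top β _) hη'
  rw [← Set.compl_eq_univ_sdiff] at hKα hLβ
  refine ⟨K ∪ L, hK.union hL, fun π hπ => ?_⟩
  have := isProbabilityMeasure_of_mem_couplings hπ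
  have h1 : π (Prod.fst ⁻¹' Kᶜ) < ENNReal.ofReal (η / 2) := by
    rwa [← Measure.map_apply measurable_fst hK.measurableSet.compl, hπ.1]
  have h2 : π (Prod.snd ⁻¹' Lᶜ) < ENNReal.ofReal (η / 2) := by
    rwa [← Measure.map_apply measurable_snd hL.measurableSet.compl, hπ.2]
  have h3 : π ((K ∪ L) ×ˢ (K ∪ L))ᶜ < ENNReal.ofReal η := by
    calc π ((K ∪ L) ×ˢ (K ∪ L))ᶜ ≤ π (Prod.fst ⁻¹' Kᶜ ∪ Prod.snd ⁻¹' Lᶜ) := by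
          refine measure_mono fun z hz => ?_
          by_contra h
          simp only [Set.mem_union, Set.mem_preimage, Set.mem_compl_iff, not_or, not_not] at h
          exact hz ⟨Or.inl h.1, Or.inr h.2⟩
      _ ≤ π (Prod.fst ⁻¹' Kᶜ) + π (Prod.snd ⁻¹' Lᶜ) := measure_union_le _ _
      _ < ENNReal.ofReal (η / 2) + ENNReal.ofReal (η / 2) := ENNReal.add_lt_add h1 h2
      _ = ENNReal.ofReal η := by
          rw [← ENNReal.ofReal_add (by positivity) (by positivity), add_halves]
  exact (ENNReal.lt_ofReal_iff_toReal_lt (measure_ne_top _ _)).1 h3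

/-- The product σ-algebra need not contain the open sets of `X × X`, but a coupling of Radon
measures is carried by a countable union of squares of compact sets, which are separable. -/
lemma aestronglyMeasurable_of_mem_couplings {π : Measure (X × X)} (hπ : π ∈ couplings α β)
    {f : X × X → ℝ} (hf : Continuous f) : AEStronglyMeasurable f π := by
  have := isProbabilityMeasure_of_mem_couplings hπ
  have hex : ∀ n : ℕ, ∃ K : Set X, IsCompact K ∧ π.real (K ×ˢ K)ᶜ < 1 / (n + 1 : ℝ) := fun n =>
    let ⟨K, hK, h⟩ := exists_isCompact_measure_compl_lt (α := α) (β := β)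
      (show (0 : ℝ) < 1 / (n + 1 : ℝ) by positivity)
    ⟨K, hK, h π hπ⟩
  choose K hK hKπ using hex
  have hnull : π.real (⋃ n, K n ×ˢ K n)ᶜ = 0 := by
    refine le_antisymm (ge_of_tendsto' tendsto_one_div_add_atTop_nhds_zero_nat fun n => ?_)
      measureReal_nonneg
    exact (measureReal_mono (Set.compl_subset_compl.2
      (Set.subset_iUnion (fun n => K n ×ˢ K n) n))).trans (hKπ n).le
  rw [← Measure.restrict_eq_self_of_ae_mem (μ := π) (s := ⋃ n, K n ×ˢ K n)
    (by rwa [measureReal_eq_zero_iff] at hnull), aestronglyMeasurable_iUnion_iff]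
  intro n
  have : CompactSpace (K n) := isCompact_iff_compactSpace.1 (hK n)
  have hKm := (hK n).measurableSet
  have he : MeasurableEmbedding (Prod.map (Subtype.val : K n → X) (Subtype.val : K n → X)) :=
    (MeasurableEmbedding.subtype_coe hKm).prodMap (MeasurableEmbedding.subtype_coe hKm)
  have hr : Set.range (Prod.map (Subtype.val : K n → X) (Subtype.val : K n → X)) =
      K n ×ˢ K n := by
    rw [Set.range_prodMap, Subtype.range_coe]
  rw [← hr, ← he.map_comap, he.aestronglyMeasurable_map_iff]
  exact (hf.comp (by fun_prop)).measurable.aestronglyMeasurable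

/-- Every coupling of finite cost is approximated, in cost, by couplings of finite entropy:
average it over small blocks that exhaust most of the mass, and complete the result. -/
lemma exists_isPlanDensity_integral_le {c : X × X → ℝ} (hcont : Continuous c)
    (hc0 : ∀ z, 0 ≤ c z) (hc : Integrable c (α.prod β)) {π : Measure (X × X)}
    (hπ : π ∈ couplings α β) (hcπ : Integrable c π) {δ : ℝ} (hδ : 0 < δ) :
    ∃ p, IsPlanDensity c α β p ∧
      ∫ z, p z * c z ∂(α.prod β) ≤ ∫ z, c z ∂π + δ := by
  have := isProbabilityMeasure_of_mem_couplings hπ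
  obtain ⟨η, hη, hcompl⟩ := exists_isPlanDensity_of_subcoupling hc hc0 (half_pos hδ)
  obtain ⟨K, hK, hKπ⟩ := exists_isCompact_measure_compl_lt (α := α) (β := β) hη
  obtain ⟨r, hr, hunif⟩ := Metric.uniformContinuousOn_iff.1
    ((hK.prod hK).uniformContinuousOn_of_continuous hcont.continuousOn) (δ / 2) (half_pos hδ)
  obtain ⟨T, hT, hTd, hTK, hTr⟩ := exists_finite_partition hK hK.measurableSet hr
  have hsub : ∀ A ∈ T, A ⊆ K := fun A hA => hTK ▸ Set.subset_biUnion_of_mem (u := id) hA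
  have hU : (⋃ W ∈ T ×ˢ T, W.1 ×ˢ W.2) = K ×ˢ K := by
    ext ⟨x, y⟩
    rw [← hTK]
    simp only [Finset.mem_product, Set.mem_iUnion, Set.mem_prod, exists_prop, Prod.exists]
    constructor
    · rintro ⟨A, B, ⟨hA, hB⟩, hx, hy⟩
      exact ⟨⟨A, hA, hx⟩, B, hB, hy⟩
    · rintro ⟨⟨A, hA, hx⟩, B, hB, hy⟩
      exact ⟨A, B, ⟨hA, hB⟩, hx, hy⟩
  obtain ⟨p, hp, hle⟩ := hcompl (blockDensity α β π T) (measurable_blockDensity hT)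
    blockDensity_nonneg ⟨_, blockDensity_le⟩ (integral_blockDensity_left_le_one hπ hT hTd)
    (integral_blockDensity_right_le_one hπ hT hTd) (by
      rw [integral_blockDensity hπ hT hTd, hU]
      have := hKπ π hπ
      rw [probReal_compl_eq_one_sub (hK.measurableSet.prod hK.measurableSet)] at this
      linarith)
  refine ⟨p, hp, hle.trans ?_⟩
  have := integral_blockDensity_mul_le hπ hT hTd hc hc0 hcπ (half_pos hδ).le ?_
  · linarith
  intro W hW z hz z' hz'
  rw [Finset.mem_product] at hW
  have h := hunif z ⟨hsub _ hW.1 hz.1, hsub _ hW.2 hz.2⟩ z' ⟨hsub _ hW.1 hz'.1, hsub _ hW.2 hz'.2⟩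
    (max_lt (hTr _ hW.1 _ hz.1 _ hz'.1) (hTr _ hW.2 _ hz.2 _ hz'.2))
  rw [Real.dist_eq] at h
  linarith [(abs_lt.1 h).2]

lemma otCost_self {c : X × X → ℝ} (hcont : Continuous c) (hc0 : ∀ z, 0 ≤ c z)
    (hdiag : ∀ x, c (x, x) = 0) : otCost c α α = 0 := by
  have hd : Measurable fun x : X => (x, x) := by fun_prop
  have hπ : α.map (fun x => (x, x)) ∈ couplings α α := by
    constructor
    · rw [Measure.map_map measurable_fst hd]
      exact Measure.map_id
    · rw [Measure.map_map measurable_snd hd]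
      exact Measure.map_id
  have hm := aestronglyMeasurable_of_mem_couplings hπ hcont
  refine le_antisymm (csInf_le (bddBelow_otCost hc0) ⟨_, hπ, ?_, ?_⟩) ?_
  · rw [integrable_map_measure hm hd.aemeasurable]
    simp [Function.comp_def, hdiag]
  · rw [integral_map hd.aemeasurable hm]
    simp [hdiag]
  · refine Real.sInf_nonneg ?_
    rintro _ ⟨π, -, -, rfl⟩
    exact integral_nonneg hc0

end Radon

end Blocks

end Sinkhorn

theorem theorem1 {X : Type*} [MetricSpace X] [MeasurableSpace X] [BorelSpace X]
    (μ ν : Measure X) [IsProbabilityMeasure μ] [IsProbabilityMeasure ν]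
    [μ.InnerRegular] [ν.InnerRegular]
    (c : X × X → ℝ) (hc : Continuous c)
    (hbelow : ∃ a : X → ℝ, Integrable a μ ∧ Integrable a ν ∧ ∀ x y, -(a x + a y) ≤ c (x, y))
    (hμν : Integrable c (μ.prod ν)) (hμμ : Integrable c (μ.prod μ))
    (hνν : Integrable c (ν.prod ν)) :
    (∀ ε : ℝ, 0 < ε →
      (∃! π, Sinkhorn.IsRegOptimal c ε μ ν π) ∧
      (∃! π, Sinkhorn.IsRegOptimal c ε μ μ π) ∧
      (∃! π, Sinkhorn.IsRegOptimal c ε ν ν π)) ∧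
    ((∀ x y, 0 ≤ c (x, y)) → (∀ x, c (x, x) = 0) →
      Tendsto (fun ε : ℝ => Sinkhorn.sinkhornLoss c ε μ ν) (𝓝[>] 0)
        (𝓝 (2 * Sinkhorn.otCost c μ ν))) ∧
    Tendsto (fun ε : ℝ => Sinkhorn.sinkhornLoss c ε μ ν) atTop
      (𝓝 (Sinkhorn.mmd (fun z => -c z) μ ν)) ∧
    (∀ f : BoundedContinuousFunction (X × X) ℝ,
      Tendsto (fun ε : ℝ => ∫ z, f z ∂(Sinkhorn.regCoupling c ε μ ν)) atTop
        (𝓝 (∫ z, f z ∂(μ.prod ν)))) := by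
  obtain ⟨a, haμ, haν, hab⟩ := hbelow
  refine ⟨fun ε hε => ⟨Sinkhorn.existsUnique_isRegOptimal hε hμν haμ haν hab,
    Sinkhorn.existsUnique_isRegOptimal hε hμμ haμ haμ hab,
    Sinkhorn.existsUnique_isRegOptimal hε hνν haν haν hab⟩, fun hpos hdiag => ?_, ?_, fun f => ?_⟩
  · have hc0 : ∀ z, 0 ≤ c z := fun z => hpos z.1 z.2
    have h1 := Sinkhorn.tendsto_regCost_zero hμν hc0 fun π hπ hcπ δ hδ =>
      Sinkhorn.exists_isPlanDensity_integral_le hc hc0 hμν hπ hcπ hδ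
    have h2 := Sinkhorn.tendsto_regCost_zero hμμ hc0 fun π hπ hcπ δ hδ =>
      Sinkhorn.exists_isPlanDensity_integral_le hc hc0 hμμ hπ hcπ hδ
    have h3 := Sinkhorn.tendsto_regCost_zero hνν hc0 fun π hπ hcπ δ hδ =>
      Sinkhorn.exists_isPlanDensity_integral_le hc hc0 hνν hπ hcπ hδ
    have := ((h1.const_mul 2).sub h2).sub h3
    rwa [Sinkhorn.otCost_self hc hc0 hdiag, Sinkhorn.otCost_self hc hc0 hdiag, sub_zero,
      sub_zero] at this
  · have := (((Sinkhorn.tendsto_regCost_atTop hμν haμ haν hab).const_mul 2).sub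
      (Sinkhorn.tendsto_regCost_atTop hμμ haμ haμ hab)).sub
      (Sinkhorn.tendsto_regCost_atTop hνν haν haν hab)
    have e : Sinkhorn.mmd (fun z => -c z) μ ν =
        2 * ∫ z, c z ∂(μ.prod ν) - ∫ z, c z ∂(μ.prod μ) - ∫ z, c z ∂(ν.prod ν) := by
      simp only [Sinkhorn.mmd, integral_neg]
      ring
    rw [e]
    exact this
  · exact Sinkhorn.tendsto_integral_regCoupling_atTop hμν haμ haν hab
      (Sinkhorn.aestronglyMeasurable_of_mem_couplings Sinkhorn.prod_mem_couplings f.continuous)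
      f.norm_coe_le_norm
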